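/- **Notation.** Let $n\in\mathbb N$, $\langle z\rangle=(1+|z|^2)^{1/2}$ and $\text{đ}\xi=(2\pi)^{-n}d\xi$. All nets are indexed by $\epsilon\in(0,1]$. - $\mathcal E_\tau(\mathbb R^n)$ is the set of nets $(u_\epsilon)_\epsilon$ of smooth functions $u_\epsilon:\mathbb R^n\to\mathbb C$ such that for every $\alpha\in\mathbb N^n$ there is $N\in\mathbb N$ with $\sup_{\epsilon}\epsilon^{N}\|\langle x\rangle^{-N}\partial^\alpha u_\epsilon\|_{L^\infty}<\infty$. - $\mathcal N_{\mathcal S}(\mathbb R^n)$ is the set of nets of smooth functions with $\sup_\epsilon\epsilon^{-q}\|x^\alpha\partial^\beta u_\epsilon\|_{L^\infty}<\infty$ for all $\alpha,\beta\in\mathbb N^n$, $q\in\mathbb N$. - $\mathcal G_{\tau,\mathcal S}(\mathbb R^n)=\mathcal E_\tau(\mathbb R^n)/\mathcal N_{\mathcal S}(\mathbb R^n)$. - A mollifier is a function $\varphi\in\mathcal S(\mathbb R^n)$ with $\int\varphi=1$ and $\int x^\alpha\varphi(x)\,dx=0$ for all $\alpha\ne0$. Put $\varphi_\epsilon(x)=\epsilon^{-n}\varphi(x/\epsilon)$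 and $\widehat f(\xi)=\int e^{-ix\xi}f(x)\,dx$. - A weight function is a continuous $\Lambda:\mathbb R^{2n}\to\mathbb R$ for which there are $\mu>0$ and constants such that (i) $\langle z\rangle^\mu\prec\Lambda(z)\prec\langle z\rangle$; (ii) $\Lambda(z)\prec\Lambda(\zeta)\prec\Lambda(z)$ whenever $|\zeta-z|\le\mu\Lambda(z)$; (iii) for every $t\in\mathbb R^{2n}$, $\Lambda(t_1z_1,\dots,t_{2n}z_{2n})\prec\Lambda(z)$. Here $f\prec g$ means $f\le cg$ with a constant $c>0$ independent of the points $z,\zeta$ (in (iii) it may depend on $t$). - For $m\in\mathbb R$ and $\rho\in(0,1]$, $\overline{\mathcal S}^m_{\Lambda,\rho}$ is the set of nets $(a_\epsilon)_\epsilon$ of smooth functions $a_\epsilon(x,y,\xi)$ on $\mathbb R^{3n}$ for which there is $m'\in\mathbb R$ such that for all $\alpha,\beta,\gamma\in\mathbb N^n$ there are $N\in\mathbb N$, $c>0$ with $$|\partial^\alpha_\xi\partial^\beta_x\partial^\gamma_y a_\epsilon(x,y,\xi)|\le c\,\Lambda(x,\xi)^m\langle x-y\rangle^{m'}\bigl(1+\Lambda(x,\xi)\langle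 x-y\rangle^{-m'}\bigr)^{-\rho|\alpha+\beta+\gamma|}\epsilon^{-N}$$ for all $\epsilon\in(0,1]$ and $(x,y,\xi)\in\mathbb R^{3n}$. The set $\overline{\mathcal N}^m_{\Lambda,\rho}$ of negligible amplitudes consists of those $(a_\epsilon)_\epsilon\in\overline{\mathcal S}^m_{\Lambda,\rho}$ for which there is $m'\in\mathbb R$ such that for all $\alpha,\beta,\gamma\in\mathbb N^n$ and all $q\in\mathbb N$ this estimate holds for some $c>0$ with $\epsilon^{q}$ in place of $\epsilon^{-N}$. - The oscillatory integral $\int e^{i\omega(z)}b(z)\,dz$ is the limit of the absolutely convergent integrals $\int e^{i\omega(z)}b(z)\psi(hz)\,dz$ as $h\to0^+$, if it exists and is the same for every Schwartz function $\psi$ with $\psi(0)=1$. **Theorem 5.1.** Let $\varphi$ be a mollifier, $\Lambda$ a weight function, $m\in\mathbb R$, $\rho\in(0,1]$ and $(a_\epsilon)_\epsilon\in\overline{\mathcal S}^m_{\Lambda,\rho}$. For every $(u_\epsilon)_\epsilon\in\mathcal E_\tau(\mathbb R^n)$, $\epsilon\in(0,1]$ and $x\in\mathbb R^n$ the oscillatory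 integral $$A_\epsilon u_\epsilon(x)=\int_{\mathbb R^{2n}}e^{i(x-y)\xi}a_\epsilon(x,y,\xi)u_\epsilon(y)\widehat{\varphi_\epsilon}(y)\,dy\,\text{đ}\xi ,$$ with phase $-y\xi$ in the variables $(y,\xi)$, exists, and 1. $(u_\epsilon)_\epsilon\in\mathcal E_\tau(\mathbb R^n)$ implies $(A_\epsilon u_\epsilon)_\epsilon\in\mathcal E_\tau(\mathbb R^n)$; 2. $(u_\epsilon)_\epsilon\in\mathcal N_{\mathcal S}(\mathbb R^n)$ implies $(A_\epsilon u_\epsilon)_\epsilon\in\mathcal N_{\mathcal S}(\mathbb R^n)$; 3. if $(a_\epsilon)_\epsilon\in\overline{\mathcal N}^m_{\Lambda,\rho}$, then $(u_\epsilon)_\epsilon\in\mathcal E_\tau(\mathbb R^n)$ implies $(A_\epsilon u_\epsilon)_\epsilon\in\mathcal N_{\mathcal S}(\mathbb R^n)$. Hence there is exactly one linear map $A:\mathcal G_{\tau,\mathcal S}(\mathbb R^n)\to\mathcal G_{\tau,\mathcal S}(\mathbb R^n)$ sending the class of each $(u_\epsilon)_\epsilon\in\mathcal E_\tau(\mathbb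 R^n)$ to the class of $(A_\epsilon u_\epsilon)_\epsilon$. -/

import Mathlib

namespace Colombeau

noncomputable section

/-- `ℝⁿ` with its Euclidean norm. -/
abbrev Rn (n : ℕ) : Type := EuclideanSpace ℝ (Fin n)

/-- `ℝ²ⁿ = ℝⁿ × ℝⁿ` with its Euclidean norm; its points are `WithLp.toLp 2 (x, ξ)`. -/
abbrev R2n (n : ℕ) : Type := WithLp 2 (Rn n × Rn n)

/-- The parameter set `(0, 1]`. -/
abbrev Param : Type := Set.Ioc (0 : ℝ) 1

/-- Nets `(u_ε)_ε`, `ε ∈ (0, 1]`, of complex functions on `V`. -/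
abbrev Net (V : Type) : Type := Param → V → ℂ

/-- `⟨x⟩ = (1 + |x|²)^(1/2)`. -/
def japanese {V : Type} [NormedAddCommGroup V] (x : V) : ℝ :=
  Real.sqrt (1 + ‖x‖ ^ 2)

/-- The length `|α| = ∑ i, α i` of a multi-index. -/
abbrev order {n : ℕ} (α : Fin n → ℕ) : ℕ := ∑ i, α i

/-- The monomial `x ^ α`. -/
def monomial {n : ℕ} (α : Fin n → ℕ) (x : Rn n) : ℝ := ∏ i, x i ^ α i

/-- The list of coordinate vectors `e₁, …, e₁, e₂, …, e₂, …` of length `|α|`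
in which `e_i` occurs `α i` times. -/
def directions {n : ℕ} (α : Fin n → ℕ) : Fin (order α) → Rn n :=
  fun j => EuclideanSpace.single (finSigmaFinEquiv.symm j).1 1

/-- The partial derivative `∂^α f (x)`: the iterated Fréchet derivative of order `|α|`
evaluated at the coordinate vectors prescribed by `α` (used for smooth `f` only). -/
def partialD {n : ℕ} (α : Fin n → ℕ) (f : Rn n → ℂ) (x : Rn n) : ℂ :=
  iteratedFDeriv ℝ (order α) f x (directions α)

/-- The mixed partial derivative `∂_ξ^α ∂_x^β ∂_y^γ f (x, y, ξ)`. -/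
def partialD₃ {n : ℕ} (α β γ : Fin n → ℕ) (f : Rn n × Rn n × Rn n → ℂ)
    (p : Rn n × Rn n × Rn n) : ℂ :=
  iteratedFDeriv ℝ (order α + order β + order γ) f p
    (Fin.append
      (Fin.append (fun j => (0, 0, directions α j)) (fun j => (directions β j, 0, 0)))
      (fun j => (0, directions γ j, 0)))

theorem partialD_zero {n : ℕ} (α : Fin n → ℕ) (x : Rn n) :
    partialD α (0 : Rn n → ℂ) x = 0 := by
  rw [partialD, show ((0 : Rn n → ℂ)) = fun _ => (0 : ℂ) from rfl, iteratedFDeriv_fun_zero]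
  rfl

theorem partialD_add {n : ℕ} (α : Fin n → ℕ) {f g : Rn n → ℂ} (hf : ContDiff ℝ (⊤ : ℕ∞) f)
    (hg : ContDiff ℝ (⊤ : ℕ∞) g) (x : Rn n) :
    partialD α (f + g) x = partialD α f x + partialD α g x := by
  have h := iteratedFDeriv_add (𝕜 := ℝ) (i := order α)
    (hf.of_le (by exact_mod_cast le_top)) (hg.of_le (by exact_mod_cast le_top))
  rw [partialD, h]
  rfl

theorem partialD_smul {n : ℕ} (α : Fin n → ℕ) {f : Rn n → ℂ} (hf : ContDiff ℝ (⊤ : ℕ∞) f)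
    (c : ℂ) (x : Rn n) : partialD α (c • f) x = c * partialD α f x := by
  have hf' : ContDiff ℝ (order α) f := hf.of_le (by exact_mod_cast le_top)
  rw [partialD, iteratedFDeriv_const_smul_apply hf'.contDiffAt]
  rfl

/-! ### The spaces of nets and the factor space -/

/-- `ℰ_τ(ℝⁿ)`: nets of smooth functions such that for all `α` there is `N` with
`sup_ε ε^N ‖⟨x⟩^(-N) ∂^α u_ε‖_∞ < ∞`. -/
def ETau (n : ℕ) : Submodule ℂ (Net (Rn n)) where
  carrier := {u | (∀ ε, ContDiff ℝ (⊤ : ℕ∞) (u ε)) ∧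
    ∀ α : Fin n → ℕ, ∃ N : ℕ, ∃ C : ℝ, ∀ (ε : Param) (x : Rn n),
      (ε : ℝ) ^ N * ((japanese x ^ N)⁻¹ * ‖partialD α (u ε) x‖) ≤ C}
  zero_mem' := by
    refine ⟨fun ε => contDiff_const, fun α => ⟨0, 0, fun ε x => ?_⟩⟩
    have h := partialD_zero α x
    simp [h]
  add_mem' := by
    rintro u v ⟨hu, hu'⟩ ⟨hv, hv'⟩
    refine ⟨fun ε => (hu ε).add (hv ε), fun α => ?_⟩
    obtain ⟨N, C, hC⟩ := hu' α
    obtain ⟨M, D, hD⟩ := hv' α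
    refine ⟨N + M, C + D, fun ε x => ?_⟩
    have h : partialD α ((u + v) ε) x = partialD α (u ε) x + partialD α (v ε) x :=
      partialD_add _ (hu ε) (hv ε) x
    have hε0 : (0 : ℝ) < ε := ε.2.1
    have hε1 : (ε : ℝ) ≤ 1 := ε.2.2
    have hJ : 1 ≤ japanese x := by
      rw [japanese]; exact Real.one_le_sqrt.2 (by nlinarith [sq_nonneg ‖x‖])
    have key : ∀ (K L : ℕ) (t : ℝ), 0 ≤ t →
        (ε : ℝ) ^ (K + L) * ((japanese x ^ (K + L))⁻¹ * t) ≤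
          (ε : ℝ) ^ K * ((japanese x ^ K)⁻¹ * t) := by
      intro K L t ht
      have h1 : (ε : ℝ) ^ (K + L) ≤ (ε : ℝ) ^ K :=
        pow_le_pow_of_le_one hε0.le hε1 (Nat.le_add_right _ _)
      have h2 : (japanese x ^ (K + L))⁻¹ ≤ (japanese x ^ K)⁻¹ :=
        inv_anti₀ (by positivity) (pow_le_pow_right₀ hJ (Nat.le_add_right _ _))
      have h3 : 0 ≤ (japanese x ^ (K + L))⁻¹ := by positivity
      exact mul_le_mul h1 (mul_le_mul_of_nonneg_right h2 ht) (mul_nonneg h3 ht) (by positivity)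
    have k1 := key N M _ (norm_nonneg (partialD α (u ε) x))
    have k2 := key M N _ (norm_nonneg (partialD α (v ε) x))
    rw [add_comm M N] at k2
    have hpos : 0 ≤ (ε : ℝ) ^ (N + M) * (japanese x ^ (N + M))⁻¹ := by positivity
    have k3 := mul_le_mul_of_nonneg_left
      (norm_add_le (partialD α (u ε) x) (partialD α (v ε) x)) hpos
    rw [h]
    have := hC ε x
    have := hD ε x
    nlinarith
  smul_mem' := by
    rintro c u ⟨hu, hu'⟩
    refine ⟨fun ε => (hu ε).const_smul c, fun α => ?_⟩
    obtain ⟨N, C, hC⟩ := hu' α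
    refine ⟨N, ‖c‖ * C, fun ε x => ?_⟩
    have h : partialD α ((c • u) ε) x = c * partialD α (u ε) x :=
      partialD_smul _ (hu ε) c x
    rw [h, norm_mul]
    have := mul_le_mul_of_nonneg_left (hC ε x) (norm_nonneg c)
    nlinarith

/-- `𝒩_𝒮(ℝⁿ)`: nets of smooth functions such that for all `α`, `β` and `q`,
`sup_ε ε^(-q) ‖x^α ∂^β u_ε‖_∞ < ∞`. -/
def NS (n : ℕ) : Submodule ℂ (Net (Rn n)) where
  carrier := {u | (∀ ε, ContDiff ℝ (⊤ : ℕ∞) (u ε)) ∧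
    ∀ (α β : Fin n → ℕ) (q : ℕ), ∃ C : ℝ, ∀ (ε : Param) (x : Rn n),
      ((ε : ℝ) ^ q)⁻¹ * ‖(monomial α x : ℂ) * partialD β (u ε) x‖ ≤ C}
  zero_mem' := by
    refine ⟨fun ε => contDiff_const, fun α β q => ⟨0, fun ε x => ?_⟩⟩
    have h := partialD_zero β x
    simp [h]
  add_mem' := by
    rintro u v ⟨hu, hu'⟩ ⟨hv, hv'⟩
    refine ⟨fun ε => (hu ε).add (hv ε), fun α β q => ?_⟩
    obtain ⟨C, hC⟩ := hu' α β q
    obtain ⟨D, hD⟩ := hv' α β q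
    refine ⟨C + D, fun ε x => ?_⟩
    have h : partialD β ((u + v) ε) x = partialD β (u ε) x + partialD β (v ε) x :=
      partialD_add _ (hu ε) (hv ε) x
    have hpos : 0 ≤ ((ε : ℝ) ^ q)⁻¹ := inv_nonneg.2 (pow_nonneg ε.2.1.le _)
    rw [h, mul_add]
    have k := mul_le_mul_of_nonneg_left (norm_add_le
      ((monomial α x : ℂ) * partialD β (u ε) x) ((monomial α x : ℂ) * partialD β (v ε) x)) hpos
    have := hC ε x
    have := hD ε x
    linarith
  smul_mem' := by
    rintro c u ⟨hu, hu'⟩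
    refine ⟨fun ε => (hu ε).const_smul c, fun α β q => ?_⟩
    obtain ⟨C, hC⟩ := hu' α β q
    refine ⟨‖c‖ * C, fun ε x => ?_⟩
    have h : partialD β ((c • u) ε) x = c * partialD β (u ε) x :=
      partialD_smul _ (hu ε) c x
    rw [h, mul_left_comm, norm_mul]
    have := mul_le_mul_of_nonneg_left (hC ε x) (norm_nonneg c)
    linarith

/-- The factor space `𝒢_{τ,𝒮}(ℝⁿ) = ℰ_τ(ℝⁿ) / 𝒩_𝒮(ℝⁿ)`. -/
abbrev GTauS (n : ℕ) : Type := ETau n ⧸ (NS n).submoduleOf (ETau n)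

/-- The class in `𝒢_{τ,𝒮}(ℝⁿ)` of a net in `ℰ_τ(ℝⁿ)`. -/
abbrev GTauS.mk {n : ℕ} (u : ETau n) : GTauS n := Submodule.Quotient.mk u

/-! ### Mollifiers -/

/-- A Schwartz function with integral one all of whose higher moments vanish. -/
def IsMollifier {n : ℕ} (φ : SchwartzMap (Rn n) ℂ) : Prop :=
  ∫ x, φ x = 1 ∧ ∀ α : Fin n → ℕ, α ≠ 0 → ∫ x, (monomial α x : ℂ) * φ x = 0

/-- `φ_ε(x) = ε^(-n) φ(x / ε)`. -/
def scaled {n : ℕ} (φ : SchwartzMap (Rn n) ℂ) (ε : Param) (x : Rn n) : ℂ :=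
  (((ε : ℝ) ^ n)⁻¹ : ℝ) * φ ((ε : ℝ)⁻¹ • x)

/-- The Fourier transform `f̂(ξ) = ∫ e^{-i x ξ} f(x) dx`. -/
def hat {n : ℕ} (f : Rn n → ℂ) (ξ : Rn n) : ℂ :=
  ∫ x, Complex.exp (-Complex.I * (inner ℝ x ξ : ℝ)) * f x

/-! ### Weight functions and amplitudes -/

/-- Weight functions on `ℝ²ⁿ`. -/
structure IsWeight {n : ℕ} (Λ : R2n n → ℝ) : Prop where
  continuous : Continuous Λ
  /-- Conditions i) and ii), with the same `μ`:
  `⟨z⟩^μ ≺ Λ(z) ≺ ⟨z⟩`, and `Λ(z) ∼ Λ(ζ)` for `|ζ - z| ≤ μ Λ(z)`. -/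
  bounds : ∃ μ > (0 : ℝ),
    (∃ c > (0 : ℝ), ∀ z, japanese z ^ μ ≤ c * Λ z) ∧
    (∃ c > (0 : ℝ), ∀ z, Λ z ≤ c * japanese z) ∧
    (∃ c > (0 : ℝ), ∀ z ζ, ‖ζ - z‖ ≤ μ * Λ z → Λ z ≤ c * Λ ζ) ∧
    (∃ c > (0 : ℝ), ∀ z ζ, ‖ζ - z‖ ≤ μ * Λ z → Λ ζ ≤ c * Λ z)
  /-- Condition iii): `Λ(tz) ≺ Λ(z)` for every `t = (s, r)` in `ℝ²ⁿ`, where `tz` is the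
  coordinatewise product. -/
  scaling : ∀ s r : Fin n → ℝ, ∃ c > (0 : ℝ), ∀ x ξ : Rn n,
    Λ (WithLp.toLp 2 (WithLp.toLp 2 (fun i => s i * x i), WithLp.toLp 2 (fun i => r i * ξ i))) ≤
      c * Λ (WithLp.toLp 2 (x, ξ))

/-- `Λ(x,ξ)^m ⟨x-y⟩^{m'} (1 + Λ(x,ξ) ⟨x-y⟩^{-m'})^{-ρ k}`, where `k = |α + β + γ|`. -/
def amplitudeWeight {n : ℕ} (Λ : R2n n → ℝ) (ρ m m' : ℝ) (k : ℕ) (x y ξ : Rn n) : ℝ :=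
  Λ (WithLp.toLp 2 (x, ξ)) ^ m * japanese (x - y) ^ m' *
    (1 + Λ (WithLp.toLp 2 (x, ξ)) * japanese (x - y) ^ (-m')) ^ (-(ρ * k))

/-- The amplitudes `S̄^m_{Λ,ρ}`; the exponent `m'` does not depend on the derivatives. -/
def Amplitude {n : ℕ} (Λ : R2n n → ℝ) (m ρ : ℝ) : Set (Net (Rn n × Rn n × Rn n)) :=
  {a | (∀ ε, ContDiff ℝ (⊤ : ℕ∞) (a ε)) ∧
    ∃ m' : ℝ, ∀ α β γ : Fin n → ℕ, ∃ N : ℕ, ∃ c > (0 : ℝ), ∀ (ε : Param) (x y ξ : Rn n),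
      ‖partialD₃ α β γ (a ε) (x, y, ξ)‖ ≤
        c * amplitudeWeight Λ ρ m m' (order (α + β + γ)) x y ξ * ((ε : ℝ) ^ N)⁻¹}

/-- The negligible amplitudes `N̄^m_{Λ,ρ}`. -/
def NegligibleAmplitude {n : ℕ} (Λ : R2n n → ℝ) (m ρ : ℝ) : Set (Net (Rn n × Rn n × Rn n)) :=
  {a | a ∈ Amplitude Λ m ρ ∧
    ∃ m' : ℝ, ∀ (α β γ : Fin n → ℕ) (q : ℕ), ∃ c > (0 : ℝ), ∀ (ε : Param) (x y ξ : Rn n),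
      ‖partialD₃ α β γ (a ε) (x, y, ξ)‖ ≤
        c * amplitudeWeight Λ ρ m m' (order (α + β + γ)) x y ξ * (ε : ℝ) ^ q}

/-! ### Oscillatory integrals and the operator -/

/-- The oscillatory integral `∫ e^{i ω(z)} b(z) dz` exists and equals `I`: for every Schwartz
function `ψ` with `ψ(0) = 1` the regularized integrals `∫ e^{i ω(z)} b(z) ψ(hz) dz` converge
absolutely and tend to `I` as `h → 0⁺`. A cutoff `ψ ∈ C_c^∞` along `h = 2^(-j)` is a
special case. -/
def IsOscIntegral {V : Type} [NormedAddCommGroup V] [NormedSpace ℝ V]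
    [MeasureTheory.MeasureSpace V] (ω : V → ℝ) (b : V → ℂ) (I : ℂ) : Prop :=
  ∀ ψ : SchwartzMap V ℂ, ψ 0 = 1 →
    (∀ h : ℝ, 0 < h →
      MeasureTheory.Integrable (fun z => Complex.exp (Complex.I * ω z) * b z * ψ (h • z))) ∧
    Filter.Tendsto (fun h : ℝ => ∫ z, Complex.exp (Complex.I * ω z) * b z * ψ (h • z))
      (nhdsWithin 0 (Set.Ioi 0)) (nhds I)

open Classical in
/-- The value of the oscillatory integral (`0` if it does not exist). -/
def oscIntegral {V : Type} [NormedAddCommGroup V] [NormedSpace ℝ V]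
    [MeasureTheory.MeasureSpace V] (ω : V → ℝ) (b : V → ℂ) : ℂ :=
  if h : ∃ I, IsOscIntegral ω b I then h.choose else 0

/-- The phase function `-yξ` of the variables `(y, ξ)`. -/
def phase {n : ℕ} (p : Rn n × Rn n) : ℝ := -inner ℝ p.1 p.2

/-- `b_ε(x, y, ξ) = e^{ixξ} a_ε(x,y,ξ) u_ε(y) φ̂_ε(y)` as a function of `(y, ξ)`. -/
def integrand {n : ℕ} (φ : SchwartzMap (Rn n) ℂ) (a : Net (Rn n × Rn n × Rn n))
    (u : Net (Rn n)) (ε : Param) (x : Rn n) (p : Rn n × Rn n) : ℂ :=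
  Complex.exp (Complex.I * (inner ℝ x p.2 : ℝ)) * a ε (x, p.1, p.2) * u ε p.1 *
    hat (scaled φ ε) p.1

/-- `A_ε u_ε(x) = ∫∫ e^{i(x-y)ξ} a_ε(x,y,ξ) u_ε(y) φ̂_ε(y) dy đξ` as an oscillatory integral
in `(y, ξ)`, with `đξ = (2π)^(-n) dξ`. -/
def psiDO {n : ℕ} (φ : SchwartzMap (Rn n) ℂ) (a : Net (Rn n × Rn n × Rn n))
    (u : Net (Rn n)) : Net (Rn n) :=
  fun ε x => (((2 * Real.pi) ^ n)⁻¹ : ℝ) * oscIntegral phase (integrand φ a u ε x)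

end

end Colombeau

open Colombeau

open MeasureTheory Filter Topology
open scoped ContDiff FourierTransform RealInnerProductSpace

/-! ### Families of smooth functions with weighted bounds on all derivatives -/

/-! The factor `φ̂_ε(y) = (𝓕φ)(εy/2π)` is Schwartz in `y`, and each power of decay costs only a
power of `ε⁻¹`. The amplitude weights lie below one polynomial that serves all derivatives at once.
Hence the full amplitude `a_ε(x,y,ξ) u_ε(y) φ̂_ε(y)` is, with all its derivatives, `O((1+|x|)^r
(1+|ξ|)^r (1+|y|)^(-K))` for every `K`. The `y`-integral is a Fourier integral at frequency `-ξ`: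
integration by parts gives arbitrary decay in `ξ`, and smoothness in `(x, ξ)` survives. The
`ξ`-integral then converges absolutely and is again of this kind, at frequency `x`, so the result
decays arbitrarily fast in `x`. Both passes are instances of `DerivBound.partialFourier`.

The same estimates hold uniformly in `h ∈ (0,1]` after inserting a cutoff `ψ(hy, hξ)`. Fubini and
dominated convergence therefore identify the oscillatory integral with the iterated one
(`isOscIntegral_iteratedIntegral`).

Dependence on `ε` is carried by a space `T` of admissible constants, which every step respects.
Claims 1, 2 and 3 are the single estimate `derivBound_psiDO` with the amplitude and the net each
moderate or negligible, since moderate times negligible is negligible. The map on the quotient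
exists because uniqueness of oscillatory values makes `u ↦ A_ε u_ε` linear. -/

/-- The derivatives of every order of the smooth functions `f i` are bounded by `C i * W`, where
`C` belongs to the space `T` of admissible dependences on the index. -/
def DerivBound {ι E F : Type} [NormedAddCommGroup E] [NormedSpace ℝ E]
    [NormedAddCommGroup F] [NormedSpace ℝ F] (T : Submodule ℝ (ι → ℝ)) (W : E → ℝ)
    (f : ι → E → F) : Prop :=
  (∀ i, ContDiff ℝ ∞ (f i)) ∧
    ∀ k : ℕ, ∃ C ∈ T, 0 ≤ C ∧ ∀ i p, ‖iteratedFDeriv ℝ k (f i) p‖ ≤ C i * W p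

namespace DerivBound

variable {ι E F G H : Type} [NormedAddCommGroup E] [NormedSpace ℝ E]
  [NormedAddCommGroup F] [NormedSpace ℝ F] [NormedAddCommGroup G] [NormedSpace ℝ G]
  [NormedAddCommGroup H] [NormedSpace ℝ H] {T T₁ T₂ : Submodule ℝ (ι → ℝ)} {W W₁ W₂ : E → ℝ}
  {f g : ι → E → F}

theorem mono (hf : DerivBound T W₁ f) (c : ℝ) (hc : 0 ≤ c) (hW : ∀ p, W₁ p ≤ c * W₂ p) :
    DerivBound T W₂ f := by
  refine ⟨hf.1, fun k => ?_⟩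
  obtain ⟨C, hC, hC0, h⟩ := hf.2 k
  refine ⟨c • C, T.smul_mem c hC, fun i => mul_nonneg hc (hC0 i), fun i p => (h i p).trans ?_⟩
  have := mul_le_mul_of_nonneg_left (hW p) (hC0 i)
  calc C i * W₁ p ≤ C i * (c * W₂ p) := this
    _ = (c • C) i * W₂ p := by simp only [Pi.smul_apply, smul_eq_mul]; ring

theorem add (hf : DerivBound T W f) (hg : DerivBound T W g) :
    DerivBound T W (fun i p => f i p + g i p) := by
  refine ⟨fun i => (hf.1 i).add (hg.1 i), fun k => ?_⟩
  obtain ⟨C, hC, hC0, h⟩ := hf.2 k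
  obtain ⟨D, hD, hD0, h'⟩ := hg.2 k
  refine ⟨C + D, T.add_mem hC hD, add_nonneg hC0 hD0, fun i p => ?_⟩
  change ‖iteratedFDeriv ℝ k (f i + g i) p‖ ≤ _
  rw [iteratedFDeriv_add_apply ((hf.1 i).contDiffAt.of_le (by exact_mod_cast le_top))
      ((hg.1 i).contDiffAt.of_le (by exact_mod_cast le_top))]
  refine (norm_add_le _ _).trans ?_
  have := h i p
  have := h' i p
  simp only [Pi.add_apply]
  linarith

theorem clm_comp (hf : DerivBound T W f) (L : F →L[ℝ] G) :
    DerivBound T W (fun i p => L (f i p)) := by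
  refine ⟨fun i => L.contDiff.comp (hf.1 i), fun k => ?_⟩
  obtain ⟨C, hC, hC0, h⟩ := hf.2 k
  refine ⟨‖L‖ • C, T.smul_mem _ hC, fun i => mul_nonneg (norm_nonneg _) (hC0 i), fun i p => ?_⟩
  have h1 := L.norm_iteratedFDeriv_comp_left (hf.1 i).contDiffAt (x := p) (n := k)
    (by exact_mod_cast le_top)
  refine h1.trans ?_
  have := mul_le_mul_of_nonneg_left (h i p) (norm_nonneg L)
  simp only [Pi.smul_apply, smul_eq_mul]
  linarith

theorem comp_clm (hf : DerivBound T W f) (L : G →L[ℝ] E) :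
    DerivBound T (fun q => W (L q)) (fun i q => f i (L q)) := by
  refine ⟨fun i => (hf.1 i).comp L.contDiff, fun k => ?_⟩
  obtain ⟨C, hC, hC0, h⟩ := hf.2 k
  refine ⟨‖L‖ ^ k • C, T.smul_mem _ hC, fun i => mul_nonneg (by positivity) (hC0 i),
    fun i p => ?_⟩
  have h1 := L.iteratedFDeriv_comp_right (hf.1 i) p (i := k) (by exact_mod_cast le_top)
  change ‖iteratedFDeriv ℝ k (f i ∘ L) p‖ ≤ _
  rw [h1]
  refine (ContinuousMultilinearMap.norm_compContinuousLinearMap_le _ _).trans ?_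
  have := mul_le_mul_of_nonneg_left (h i (L p)) (pow_nonneg (norm_nonneg L) k)
  simp only [Finset.prod_const, Finset.card_univ, Fintype.card_fin, Pi.smul_apply, smul_eq_mul]
  linarith

theorem fderiv (hf : DerivBound T W f) : DerivBound T W (fun i => fderiv ℝ (f i)) := by
  refine ⟨fun i => (hf.1 i).fderiv_right (by exact_mod_cast le_top), fun k => ?_⟩
  obtain ⟨C, hC, hC0, h⟩ := hf.2 (k + 1)
  refine ⟨C, hC, hC0, fun i p => ?_⟩
  rw [norm_iteratedFDeriv_fderiv]
  exact h i p

/-- Leibniz rule. Constants multiply, so all that is asked of the three spaces is that products from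
`T₁` and `T₂` land in `T`. -/
theorem bilinear {g : ι → E → G} (hf : DerivBound T₁ W₁ f) (hg : DerivBound T₂ W₂ g)
    (hT : ∀ C ∈ T₁, ∀ D ∈ T₂, C * D ∈ T) (B : F →L[ℝ] G →L[ℝ] H) :
    DerivBound T (fun p => W₁ p * W₂ p) (fun i p => B (f i p) (g i p)) := by
  refine ⟨fun i => B.isBoundedBilinearMap.contDiff.comp ((hf.1 i).prodMk (hg.1 i)), fun k => ?_⟩
  choose C hC hC0 h using hf.2
  choose D hD hD0 h' using hg.2
  refine ⟨‖B‖ • ∑ j ∈ Finset.range (k + 1), (k.choose j : ℝ) • (C j * D (k - j)),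
    T.smul_mem _ (T.sum_mem fun j _ => T.smul_mem _ (hT _ (hC _) _ (hD _))),
    smul_nonneg (norm_nonneg B) (Finset.sum_nonneg fun j _ =>
      smul_nonneg (Nat.cast_nonneg _) (mul_nonneg (hC0 _) (hD0 _))), fun i p => ?_⟩
  refine (B.norm_iteratedFDeriv_le_of_bilinear (hf.1 i) (hg.1 i) p
    (by exact_mod_cast le_top)).trans ?_
  simp only [Pi.smul_apply, Finset.sum_apply, smul_eq_mul, Pi.mul_apply, mul_assoc,
    Finset.sum_mul]
  refine mul_le_mul_of_nonneg_left (Finset.sum_le_sum fun j _ => ?_) (norm_nonneg B)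
  refine mul_le_mul_of_nonneg_left ?_ (Nat.cast_nonneg _)
  calc _ ≤ (C j i * W₁ p) * (D (k - j) i * W₂ p) :=
        mul_le_mul (h j i p) (h' (k - j) i p) (norm_nonneg _)
          ((norm_nonneg _).trans (h j i p))
    _ = _ := by ring

theorem norm_le (hf : DerivBound T W f) : ∃ C ∈ T, 0 ≤ C ∧ ∀ i p, ‖f i p‖ ≤ C i * W p := by
  obtain ⟨C, hC, hC0, h⟩ := hf.2 0
  exact ⟨C, hC, hC0, fun i p => by simpa using h i p⟩

/-- A single member of the family, considered as a constant family. -/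
theorem const (hf : DerivBound T W f) (i : ι) {κ : Type} (S : Submodule ℝ (κ → ℝ))
    (hS : ∀ c : ℝ, (fun _ => c) ∈ S) : DerivBound S W (fun _ : κ => f i) := by
  refine ⟨fun _ => hf.1 i, fun k => ?_⟩
  obtain ⟨C, hC, hC0, h⟩ := hf.2 k
  exact ⟨fun _ => C i, hS _, fun _ => hC0 i, fun _ => h i⟩

end DerivBound

/-- Only the orders 0 and 1 are nonzero, and `1 + ‖p‖` dominates both up to the factor `‖L‖`. It
serves for the linear factor produced by differentiating the phase. -/
theorem derivBound_clm {ι E F : Type} [NormedAddCommGroup E] [NormedSpace ℝ E]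
    [NormedAddCommGroup F] [NormedSpace ℝ F] (T : Submodule ℝ (ι → ℝ))
    (hT : ∀ c : ℝ, (fun _ => c) ∈ T) (L : E →L[ℝ] F) :
    DerivBound T (fun p => 1 + ‖p‖) (fun _ p => L p) := by
  refine ⟨fun _ => L.contDiff, fun k => ?_⟩
  refine ⟨fun _ => ‖L‖, hT _, fun _ => norm_nonneg _, fun i p => ?_⟩
  have hp : 1 ≤ 1 + ‖p‖ := by linarith [norm_nonneg p]
  match k with
  | 0 =>
    rw [norm_iteratedFDeriv_zero]
    refine (L.le_opNorm p).trans (mul_le_mul_of_nonneg_left (by linarith) (norm_nonneg _))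
  | 1 =>
    rw [← norm_iteratedFDeriv_fderiv, norm_iteratedFDeriv_zero, L.fderiv]
    exact le_mul_of_one_le_right (norm_nonneg _) hp
  | k + 2 =>
    rw [← norm_iteratedFDeriv_fderiv]
    have h1 : fderiv ℝ (fun p => L p) = fun _ => L := by ext1 x; exact L.fderiv
    rw [h1, iteratedFDeriv_const_of_ne (by omega)]
    simp only [Pi.zero_apply, norm_zero]
    positivity

/-! ### Integrability from decay, and decay of Fourier integrals -/

theorem integrable_one_add_norm_pow_inv (V : Type) [NormedAddCommGroup V] [NormedSpace ℝ V]
    [FiniteDimensional ℝ V] [MeasurableSpace V] [BorelSpace V] (μ : Measure V)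
    [μ.IsAddHaarMeasure] :
    Integrable (fun v : V => ((1 + ‖v‖) ^ (Module.finrank ℝ V + 1))⁻¹) μ := by
  have h := integrable_one_add_norm (μ := μ) (E := V) (r := (Module.finrank ℝ V + 1 : ℕ))
    (by push_cast; linarith)
  refine h.congr (Eventually.of_forall fun v => ?_)
  have : 0 < 1 + ‖v‖ := by positivity
  simp only
  rw [Real.rpow_neg this.le, Real.rpow_natCast]

/-- Integrability of a continuous function from a decay estimate. -/
theorem integrable_of_norm_le_inv_pow {V F : Type} [NormedAddCommGroup V] [NormedSpace ℝ V]
    [FiniteDimensional ℝ V] [MeasurableSpace V] [BorelSpace V] [NormedAddCommGroup F]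
    {μ : Measure V} [μ.IsAddHaarMeasure] {g : V → F} (hg : Continuous g) {B : ℝ}
    (h : ∀ v, ‖g v‖ ≤ B * ((1 + ‖v‖) ^ (Module.finrank ℝ V + 1))⁻¹) : Integrable g μ :=
  ((integrable_one_add_norm_pow_inv V μ).const_mul B).mono' hg.aestronglyMeasurable
    (Eventually.of_forall h)

/-- Integrating by parts `j` times costs the `L¹` norms of derivatives up to order `j`, each at most
`B` times the integral of the reference weight. The constant does not depend on `g`, which gives
uniformity in all parameters later. -/
theorem exists_fourier_decay_scalar (V : Type) [NormedAddCommGroup V] [InnerProductSpace ℝ V]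
    [FiniteDimensional ℝ V] [MeasurableSpace V] [BorelSpace V] (j : ℕ) :
    ∃ c : ℝ, 0 ≤ c ∧ ∀ (g : V → ℂ) (B : ℝ), ContDiff ℝ ∞ g →
      (∀ k ≤ j, ∀ v, ‖iteratedFDeriv ℝ k g v‖ ≤
        B * ((1 + ‖v‖) ^ (Module.finrank ℝ V + 1))⁻¹) →
      ∀ w : V, (1 + ‖w‖) ^ j * ‖∫ v, Complex.exp (Complex.I * (⟪w, v⟫ : ℝ)) * g v‖ ≤ c * B := by
  set d := Module.finrank ℝ V + 1
  set M := ∫ v : V, ((1 + ‖v‖) ^ d)⁻¹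
  have hM : 0 ≤ M := integral_nonneg fun v => by positivity
  refine ⟨2 ^ j * (M + (2 * Real.pi) ^ j * (2 ^ j * ((j + 1) * M))), by positivity,
    fun g B hg h w => ?_⟩
  have hB : 0 ≤ B := by
    have h0 := (norm_nonneg _).trans (h 0 (Nat.zero_le _) 0)
    simpa using h0
  have hint : ∀ k ≤ j, Integrable (fun v => ‖iteratedFDeriv ℝ k g v‖) := fun k hk =>
    (integrable_of_norm_le_inv_pow (hg.continuous_iteratedFDeriv (by exact_mod_cast le_top))
      (h k hk)).norm
  have hle : ∀ k ≤ j, ∫ v, ‖iteratedFDeriv ℝ k g v‖ ≤ B * M := fun k hk => by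
    rw [← integral_const_mul]
    exact integral_mono (hint k hk) ((integrable_one_add_norm_pow_inv V volume).const_mul B)
      (h k hk)
  set I := ∫ v, Complex.exp (Complex.I * (⟪w, v⟫ : ℝ)) * g v with hI
  -- The kernel of `𝓕` is `e^{-2πi⟨v,·⟩}`, hence the rescaled and reflected frequency.
  have hF : 𝓕 g (-(2 * Real.pi)⁻¹ • w) = I := by
    rw [Real.fourier_eq', hI]
    congr 1
    ext v
    rw [real_inner_smul_right, real_inner_comm, smul_eq_mul]
    congr 2
    push_cast
    field_simp
  have h0 : ‖I‖ ≤ B * M := by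
    refine (norm_integral_le_integral_norm _).trans (le_trans (le_of_eq ?_) (hle 0 (Nat.zero_le _)))
    congr 1
    ext v
    rw [norm_mul, mul_comm Complex.I, Complex.norm_exp_ofReal_mul_I, one_mul,
      norm_iteratedFDeriv_zero]
  have hj : ‖w‖ ^ j * ‖I‖ ≤ (2 * Real.pi) ^ j * (2 ^ j * ((j + 1) * (B * M))) := by
    have h1 := Real.pow_mul_norm_iteratedFDeriv_fourier_le (K := 0) (N := j) (f := g)
      (hg.of_le (by exact_mod_cast le_top))
      (fun k n hk hn => by
        have hk0 : k = 0 := by exact_mod_cast nonpos_iff_eq_zero.1 hk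
        have hn' : n ≤ j := by exact_mod_cast hn
        simpa [hk0] using hint n hn') (k := 0) (n := j) le_rfl le_rfl (-(2 * Real.pi)⁻¹ • w)
    rw [norm_iteratedFDeriv_zero, hF] at h1
    have h2 : ∑ p ∈ Finset.range (0 + 1) ×ˢ Finset.range (j + 1),
        ∫ v, ‖v‖ ^ p.1 * ‖iteratedFDeriv ℝ p.2 g v‖ ≤ (j + 1) * (B * M) := by
      rw [Finset.sum_product]
      simp only [zero_add, Finset.range_one, Finset.sum_singleton, pow_zero, one_mul]
      refine (Finset.sum_le_sum fun k hk => hle k (by simpa [Nat.lt_succ_iff] using hk)).trans ?_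
      simp
    have h3 : ‖w‖ ^ j = (2 * Real.pi) ^ j * ‖-(2 * Real.pi)⁻¹ • w‖ ^ j := by
      rw [← mul_pow, norm_smul, norm_neg, norm_inv, Real.norm_of_nonneg (by positivity)]
      field_simp
    rw [h3, mul_assoc]
    refine mul_le_mul_of_nonneg_left (h1.trans ?_) (by positivity)
    simp only [pow_zero, one_mul, CharP.cast_eq_zero, mul_zero, zero_add]
    exact mul_le_mul_of_nonneg_left h2 (by positivity)
  have h4 : (1 + ‖w‖) ^ j ≤ 2 ^ j * (1 + ‖w‖ ^ j) := by
    have hm : 1 + ‖w‖ ≤ 2 * max 1 ‖w‖ := by linarith [le_max_left 1 ‖w‖, le_max_right 1 ‖w‖]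
    refine (pow_le_pow_left₀ (by positivity) hm j).trans ?_
    rw [mul_pow]
    refine mul_le_mul_of_nonneg_left ?_ (by positivity)
    rcases max_choice 1 ‖w‖ with h | h <;> rw [h]
    · simp
    · linarith
  calc (1 + ‖w‖) ^ j * ‖I‖ ≤ 2 ^ j * (1 + ‖w‖ ^ j) * ‖I‖ :=
        mul_le_mul_of_nonneg_right h4 (norm_nonneg _)
    _ = 2 ^ j * (‖I‖ + ‖w‖ ^ j * ‖I‖) := by ring
    _ ≤ 2 ^ j * (B * M + (2 * Real.pi) ^ j * (2 ^ j * ((j + 1) * (B * M)))) := by gcongr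
    _ = _ := by ring

/-- Integration by parts: the oscillatory integral of a function whose derivatives are integrable
decays rapidly in the frequency. -/
theorem exists_fourier_decay (V : Type) [NormedAddCommGroup V] [InnerProductSpace ℝ V]
    [FiniteDimensional ℝ V] [MeasurableSpace V] [BorelSpace V] (j : ℕ) :
    ∃ c : ℝ, 0 ≤ c ∧ ∀ (F : Type) [NormedAddCommGroup F] [NormedSpace ℝ F] [NormedSpace ℂ F]
      [IsScalarTower ℝ ℂ F] [CompleteSpace F] (g : V → F) (B : ℝ), ContDiff ℝ ∞ g →
      (∀ k ≤ j, ∀ v, ‖iteratedFDeriv ℝ k g v‖ ≤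
        B * ((1 + ‖v‖) ^ (Module.finrank ℝ V + 1))⁻¹) →
      ∀ w : V, (1 + ‖w‖) ^ j * ‖∫ v, Complex.exp (Complex.I * (⟪w, v⟫ : ℝ)) • g v‖ ≤ c * B := by
  obtain ⟨c, hc, H⟩ := exists_fourier_decay_scalar V j
  refine ⟨c, hc, fun F _ _ _ _ _ g B hg h w => ?_⟩
  set I := ∫ v, Complex.exp (Complex.I * (⟪w, v⟫ : ℝ)) • g v with hI
  -- A norming functional of the integral reduces to scalar values with the same constant, whatever
  -- the space `F`.
  obtain ⟨ℓ, hℓ1, hℓ⟩ := exists_dual_vector'' ℂ I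
  have hB : 0 ≤ B := by
    have h0 := (norm_nonneg _).trans (h 0 (Nat.zero_le _) 0)
    simpa using h0
  have hgi : Integrable (fun v => Complex.exp (Complex.I * (⟪w, v⟫ : ℝ)) • g v) := by
    refine integrable_of_norm_le_inv_pow (B := B) (by have := hg.continuous; fun_prop) fun v => ?_
    rw [norm_smul, mul_comm Complex.I, Complex.norm_exp_ofReal_mul_I, one_mul]
    simpa using h 0 (Nat.zero_le _) v
  let ℓR : F →L[ℝ] ℂ := ℓ.restrictScalars ℝ
  have hℓR : ‖ℓR‖ ≤ 1 := by rwa [ContinuousLinearMap.norm_restrictScalars]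
  have key := H (fun v => ℓR (g v)) B (ℓR.contDiff.comp hg) (fun k hk v => by
    have h1 := ℓR.norm_iteratedFDeriv_comp_left hg.contDiffAt (x := v) (n := k)
      (by exact_mod_cast le_top)
    exact h1.trans ((mul_le_of_le_one_left (norm_nonneg _) hℓR).trans (h k hk v))) w
  have e : ∫ v, Complex.exp (Complex.I * (⟪w, v⟫ : ℝ)) * ℓR (g v) = ℓ I := by
    rw [hI]
    have := (ℓR.integral_comp_comm hgi)
    rw [show ℓ _ = ℓR _ from rfl, ← this]
    congr 1
    ext v
    exact (ℓ.map_smul _ _).symm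
  rw [e, hℓ] at key
  simpa using key

/-! ### Fourier integrals depending on parameters -/

section ParametricFourier

variable {ι Z V F : Type} [NormedAddCommGroup Z] [NormedSpace ℝ Z]
  [NormedAddCommGroup V] [InnerProductSpace ℝ V] [NormedAddCommGroup F] [NormedSpace ℝ F]

/-- The slice is a translate of `b` composed with the inclusion of `V`, which has norm at most one.
-/
theorem ContDiff.norm_iteratedFDeriv_prodMk_le {b : Z × V → F} (hb : ContDiff ℝ ∞ b) (k : ℕ)
    (z : Z) (v : V) :
    ‖iteratedFDeriv ℝ k (fun v => b (z, v)) v‖ ≤ ‖iteratedFDeriv ℝ k b (z, v)‖ := by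
  have h1 := (ContinuousLinearMap.inr ℝ Z V).iteratedFDeriv_comp_right
    (f := fun p => b ((z, 0) + p)) (n := ∞) (hb.comp (contDiff_const.add contDiff_id)) v (i := k)
    (by exact_mod_cast le_top)
  have h2 : (fun p => b ((z, 0) + p)) ∘ (ContinuousLinearMap.inr ℝ Z V) = fun v => b (z, v) := by
    ext v; simp
  rw [← h2, h1, iteratedFDeriv_comp_add_left]
  refine (ContinuousMultilinearMap.norm_compContinuousLinearMap_le _ _).trans ?_
  simp only [ContinuousLinearMap.inr_apply, Prod.mk_add_mk, add_zero, zero_add]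
  refine mul_le_of_le_one_right (norm_nonneg _) (Finset.prod_le_one (fun _ _ => norm_nonneg _) ?_)
  intro _ _
  exact ContinuousLinearMap.opNorm_le_bound _ zero_le_one fun x => by simp

/-- The linear forms `z ↦ ⟨v, Lz⟩`. -/
noncomputable def phaseForm (L : Z →L[ℝ] V) : V →L[ℝ] Z →L[ℝ] ℝ :=
  ((ContinuousLinearMap.compL ℝ Z V ℝ).flip L).comp (innerSL ℝ)

theorem phaseForm_apply (L : Z →L[ℝ] V) (v : V) (z : Z) : phaseForm L v z = ⟪L z, v⟫ := by
  rw [real_inner_comm]; rfl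

variable [NormedSpace ℂ F]

/-- The amplitude of the derivative of `partialFourier L b`. -/
noncomputable def derivAmplitude (L : Z →L[ℝ] V) (b : Z × V → F) (p : Z × V) : Z →L[ℝ] F :=
  (fderiv ℝ b p).comp (ContinuousLinearMap.inl ℝ Z V) +
    Complex.I • (phaseForm L p.2).smulRight (b p)

section

variable [FiniteDimensional ℝ V] [MeasurableSpace V] [BorelSpace V]

/-- `∫ e^{i⟨Lz, v⟩} b(z, v) dv`. -/
noncomputable def partialFourier (L : Z →L[ℝ] V) (b : Z × V → F) (z : Z) : F :=
  ∫ v, Complex.exp (Complex.I * (⟪L z, v⟫ : ℝ)) • b (z, v)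

theorem DerivBound.integrable_snd {T : Submodule ℝ (ι → ℝ)} {w : Z → ℝ} {b : ι → Z × V → F}
    (hb : ∀ K : ℕ, DerivBound T (fun p : Z × V => w p.1 * ((1 + ‖p.2‖) ^ K)⁻¹) b)
    (L : Z →L[ℝ] V) (i : ι) (z : Z) :
    Integrable fun v => Complex.exp (Complex.I * (⟪L z, v⟫ : ℝ)) • b i (z, v) := by
  obtain ⟨C, hC, hC0, h⟩ := (hb (Module.finrank ℝ V + 1)).norm_le
  have := ((hb 0).1 i).continuous
  refine integrable_of_norm_le_inv_pow (B := C i * w z) (by fun_prop) fun v => ?_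
  rw [norm_smul, mul_comm Complex.I, Complex.norm_exp_ofReal_mul_I, one_mul, mul_assoc]
  exact h i (z, v)

end

variable [IsScalarTower ℝ ℂ F]

theorem hasFDerivAt_exp_smul (L : Z →L[ℝ] V) {b : Z × V → F} (hb : ContDiff ℝ ∞ b) (z : Z)
    (v : V) :
    HasFDerivAt (fun z => Complex.exp (Complex.I * (⟪L z, v⟫ : ℝ)) • b (z, v))
      (Complex.exp (Complex.I * (⟪L z, v⟫ : ℝ)) • derivAmplitude L b (z, v)) z := by
  have h1 : HasFDerivAt (fun z => b (z, v))
      ((fderiv ℝ b (z, v)).comp (ContinuousLinearMap.inl ℝ Z V)) z :=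
    ((hb.differentiable (by simp)).differentiableAt.hasFDerivAt (x := (z, v))).comp z
      (hasFDerivAt_prodMk_left z v)
  have h2 : HasFDerivAt (fun z => ⟪L z, v⟫) (phaseForm L v) z := by
    simp_rw [← phaseForm_apply]
    exact (phaseForm L v).hasFDerivAt
  have h3 : HasFDerivAt (fun z => Complex.exp (Complex.I * (⟪L z, v⟫ : ℝ)))
      (Complex.exp (Complex.I * (⟪L z, v⟫ : ℝ)) •
        (Complex.I • Complex.ofRealCLM.comp (phaseForm L v))) z :=
    ((Complex.ofRealCLM.hasFDerivAt.comp z h2).const_mul Complex.I).cexp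
  refine (h3.smul h1).congr_fderiv ?_
  ext y
  simp only [derivAmplitude, add_apply, smul_apply,
    ContinuousLinearMap.smulRight_apply, ContinuousLinearMap.comp_apply, smul_add]
  simp only [Complex.ofRealCLM_apply, smul_eq_mul, mul_smul]
  congr 3
  exact algebraMap_smul ℂ (phaseForm L v y) (b (z, v))

/-- Differentiating the exponential brings down a factor linear in `v`. The lost power of `1 + ‖v‖`
is recovered from the bound for `K + 1`, so the class of amplitudes rapidly decreasing in `v` is
stable. -/
theorem DerivBound.derivAmplitude {T : Submodule ℝ (ι → ℝ)} {w : Z → ℝ}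
    {b : ι → Z × V → F} (L : Z →L[ℝ] V)
    (hb : ∀ K : ℕ, DerivBound T (fun p : Z × V => w p.1 * ((1 + ‖p.2‖) ^ K)⁻¹) b) (K : ℕ) :
    DerivBound T (fun p : Z × V => w p.1 * ((1 + ‖p.2‖) ^ K)⁻¹)
      (fun i => derivAmplitude L (b i)) := by
  have h1 := (hb K).fderiv.clm_comp
    ((ContinuousLinearMap.compL ℝ Z (Z × V) F).flip (ContinuousLinearMap.inl ℝ Z V))
  have h2 := (derivBound_clm (ι := ι) (Submodule.span ℝ {1})
    (fun c => Submodule.mem_span_singleton.2 ⟨c, by ext; simp⟩) (phaseForm L)).comp_clm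
    (ContinuousLinearMap.snd ℝ Z V)
  have h3 := (h2.bilinear (T := T) (hb (K + 1)) (by
    intro C hC D hD
    obtain ⟨c, rfl⟩ := Submodule.mem_span_singleton.1 hC
    rw [smul_mul_assoc, one_mul]
    exact T.smul_mem c hD) (ContinuousLinearMap.smulRightL ℝ Z F)).clm_comp
      (Complex.I • ContinuousLinearMap.id ℝ (Z →L[ℝ] F))
  refine h1.add (h3.mono 1 zero_le_one fun p => le_of_eq ?_)
  have : 0 < 1 + ‖p.2‖ := by positivity
  simp only [ContinuousLinearMap.coe_snd']
  field_simp
  ring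

variable [FiniteDimensional ℝ V] [MeasurableSpace V] [BorelSpace V]

theorem hasFDerivAt_partialFourier {T : Submodule ℝ (ι → ℝ)} {w : Z → ℝ} (hw : Continuous w)
    {b : ι → Z × V → F} (L : Z →L[ℝ] V)
    (hb : ∀ K : ℕ, DerivBound T (fun p : Z × V => w p.1 * ((1 + ‖p.2‖) ^ K)⁻¹) b)
    (i : ι) (z : Z) :
    HasFDerivAt (partialFourier L (b i)) (partialFourier L (derivAmplitude L (b i)) z) z := by
  obtain ⟨C, hC, hC0, h⟩ := (DerivBound.derivAmplitude L hb (Module.finrank ℝ V + 1)).norm_le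
  -- On this neighbourhood the weight is bounded, so a single integrable function dominates all
  -- derivatives in `z`.
  have hs : {y | w y < w z + 1} ∈ 𝓝 z :=
    hw.continuousAt.eventually (gt_mem_nhds (by linarith))
  refine hasFDerivAt_integral_of_dominated_of_fderiv_le
    (bound := fun v => C i * (w z + 1) * ((1 + ‖v‖) ^ (Module.finrank ℝ V + 1))⁻¹) hs
    (Eventually.of_forall fun y => (DerivBound.integrable_snd hb L i y).aestronglyMeasurable)
    (DerivBound.integrable_snd hb L i z)
    (DerivBound.integrable_snd (DerivBound.derivAmplitude L hb) L i z).aestronglyMeasurable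
    (Eventually.of_forall fun v y hy => ?_)
    ((integrable_one_add_norm_pow_inv V volume).const_mul _)
    (Eventually.of_forall fun v y _ => hasFDerivAt_exp_smul L ((hb 0).1 i) y v)
  rw [norm_smul, mul_comm Complex.I, Complex.norm_exp_ofReal_mul_I, one_mul, mul_assoc]
  refine (h i (y, v)).trans (mul_le_mul_of_nonneg_left ?_ (hC0 i))
  exact mul_le_mul_of_nonneg_right (le_of_lt hy) (by positivity)

theorem partialFourier_decay [CompleteSpace F] {T : Submodule ℝ (ι → ℝ)} {w : Z → ℝ}
    (hw0 : ∀ z, 0 ≤ w z)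
    {b : ι → Z × V → F} (L : Z →L[ℝ] V)
    (hb : ∀ K : ℕ, DerivBound T (fun p : Z × V => w p.1 * ((1 + ‖p.2‖) ^ K)⁻¹) b) (j : ℕ) :
    ∃ C ∈ T, 0 ≤ C ∧ ∀ i z, ‖partialFourier L (b i) z‖ ≤ C i * (w z * ((1 + ‖L z‖) ^ j)⁻¹) := by
  obtain ⟨c, hc, H⟩ := exists_fourier_decay V j
  choose C hC hC0 h using (hb (Module.finrank ℝ V + 1)).2
  refine ⟨c • ∑ k ∈ Finset.range (j + 1), C k, T.smul_mem _ (T.sum_mem fun k _ => hC k),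
    smul_nonneg hc (Finset.sum_nonneg fun k _ => hC0 k), fun i z => ?_⟩
  have hpos : 0 < (1 + ‖L z‖) ^ j := by positivity
  have key := H F (fun v => b i (z, v)) ((∑ k ∈ Finset.range (j + 1), C k i) * w z)
    (((hb 0).1 i).comp (contDiff_const.prodMk contDiff_id)) (fun k hk v => by
      refine (((hb 0).1 i).norm_iteratedFDeriv_prodMk_le k z v).trans ((h k i (z, v)).trans ?_)
      rw [mul_assoc]
      have := hw0 z
      exact mul_le_mul_of_nonneg_right (Finset.single_le_sum (f := fun k => C k i)
        (fun k _ => hC0 k i) (Finset.mem_range.2 (Nat.lt_succ_of_le hk))) (by positivity))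
      (L z)
  rw [← mul_assoc, ← div_eq_mul_inv, le_div_iff₀ hpos, mul_comm]
  refine key.trans (le_of_eq ?_)
  simp only [Pi.smul_apply, Finset.sum_apply, smul_eq_mul, mul_assoc]

/-- Induction on `k`: a derivative of such an integral is an integral of the same kind, with values
in `Z →L[ℝ] F`. This is why `F` is quantified inside the induction. -/
theorem partialFourier_iteratedFDeriv {T : Submodule ℝ (ι → ℝ)} {w : Z → ℝ}
    (hw : Continuous w) (hw0 : ∀ z, 0 ≤ w z) (L : Z →L[ℝ] V) (k : ℕ) :
    ∀ (F : Type) [NormedAddCommGroup F] [NormedSpace ℝ F] [NormedSpace ℂ F]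
      [IsScalarTower ℝ ℂ F] [CompleteSpace F] (b : ι → Z × V → F),
      (∀ K : ℕ, DerivBound T (fun p : Z × V => w p.1 * ((1 + ‖p.2‖) ^ K)⁻¹) b) →
      (∀ i, ContDiff ℝ k (partialFourier L (b i))) ∧ ∀ j : ℕ, ∃ C ∈ T, 0 ≤ C ∧ ∀ i z,
        ‖iteratedFDeriv ℝ k (partialFourier L (b i)) z‖ ≤
          C i * (w z * ((1 + ‖L z‖) ^ j)⁻¹) := by
  induction k with
  | zero =>
    intro F _ _ _ _ _ b hb
    refine ⟨fun i => contDiff_zero.2 (continuous_iff_continuousAt.2 fun z =>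
      (hasFDerivAt_partialFourier hw L hb i z).continuousAt), fun j => ?_⟩
    simpa only [norm_iteratedFDeriv_zero] using partialFourier_decay hw0 L hb j
  | succ k ih =>
    intro F _ _ _ _ _ b hb
    have hd := fun i z => hasFDerivAt_partialFourier hw L hb i z
    have hf : ∀ i, fderiv ℝ (partialFourier L (b i)) =
        partialFourier L (derivAmplitude L (b i)) := fun i => funext fun z => (hd i z).fderiv
    obtain ⟨h1, h2⟩ := ih _ _ (DerivBound.derivAmplitude L hb)
    refine ⟨fun i => ?_, fun j => ?_⟩
    · rw [Nat.cast_add, Nat.cast_one, contDiff_succ_iff_fderiv]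
      exact ⟨fun z => (hd i z).differentiableAt, by simp, by rw [hf]; exact h1 i⟩
    · simp_rw [← norm_iteratedFDeriv_fderiv, hf]
      exact h2 j

/-- An oscillatory integral in `v` with amplitude rapidly decreasing in `v` is a smooth function of
the parameters, rapidly decreasing in the frequency. -/
theorem DerivBound.partialFourier [CompleteSpace F] {T : Submodule ℝ (ι → ℝ)} {w : Z → ℝ}
    (hw : Continuous w) (hw0 : ∀ z, 0 ≤ w z) (L : Z →L[ℝ] V) {b : ι → Z × V → F}
    (hb : ∀ K : ℕ, DerivBound T (fun p : Z × V => w p.1 * ((1 + ‖p.2‖) ^ K)⁻¹) b) (j : ℕ) :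
    DerivBound T (fun z => w z * ((1 + ‖L z‖) ^ j)⁻¹) (fun i => partialFourier L (b i)) :=
  ⟨fun i => contDiff_infty.2 fun k => (partialFourier_iteratedFDeriv hw hw0 L k F b hb).1 i,
    fun k => (partialFourier_iteratedFDeriv hw hw0 L k F b hb).2 j⟩

end ParametricFourier

/-! ### Bounds on iterated derivatives from bounds on partial derivatives -/

theorem ContinuousMultilinearMap.norm_le_sum_basis {κ V F : Type} [Fintype κ]
    [NormedAddCommGroup V] [NormedSpace ℝ V] [NormedAddCommGroup F] [NormedSpace ℝ F]
    (e : Module.Basis κ ℝ V) (he : ∀ v j, |e.repr v j| ≤ ‖v‖) {k : ℕ}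
    (g : ContinuousMultilinearMap ℝ (fun _ : Fin k => V) F) :
    ‖g‖ ≤ ∑ s : Fin k → κ, ‖g fun i => e (s i)‖ := by
  classical
  refine g.opNorm_le_bound (by positivity) fun m => ?_
  have h1 : g m = ∑ s : Fin k → κ, (∏ i, e.repr (m i) (s i)) • g fun i => e (s i) := by
    conv_lhs => rw [show m = fun i => ∑ j, e.repr (m i) j • e j from
      funext fun i => (e.sum_repr (m i)).symm]
    rw [g.map_sum]
    exact Finset.sum_congr rfl fun s _ => g.map_smul_univ _ _
  rw [h1, Finset.sum_mul]
  refine (norm_sum_le _ _).trans (Finset.sum_le_sum fun s _ => ?_)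
  rw [norm_smul, mul_comm, Real.norm_eq_abs, Finset.abs_prod]
  exact mul_le_mul_of_nonneg_left
    (Finset.prod_le_prod (fun _ _ => abs_nonneg _) fun i _ => he (m i) (s i)) (norm_nonneg _)

/-! ### Symmetry of iterated derivatives and sorting of directions -/

section
variable {V F : Type} [NormedAddCommGroup V] [NormedSpace ℝ V]
    [NormedAddCommGroup F] [NormedSpace ℝ F] {f : V → F}

theorem iteratedFDeriv_succ_apply_eq_fderiv (hf : ContDiff ℝ ∞ f) (x : V) (k : ℕ)
    (v : Fin (k + 1) → V) :
    iteratedFDeriv ℝ (k + 1) f x v =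
      fderiv ℝ (fun y => iteratedFDeriv ℝ k f y (Fin.tail v)) x (v 0) := by
  rw [iteratedFDeriv_succ_apply_left, fderiv_continuousMultilinear_apply_const_apply]
  exact (hf.differentiable_iteratedFDeriv (by exact_mod_cast ENat.natCast_lt_top k)).differentiableAt

/-- Exchanging the two outermost directions is the symmetry of the second derivative of a
lower-order derivative. Any other adjacent exchange happens under the outermost derivative, where
induction applies. -/
theorem iteratedFDeriv_apply_comp_swap (hf : ContDiff ℝ ∞ f) (k : ℕ) (i : Fin k) (x : V)
    (v : Fin (k + 1) → V) :
    iteratedFDeriv ℝ (k + 1) f x (v ∘ Equiv.swap i.castSucc i.succ) =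
      iteratedFDeriv ℝ (k + 1) f x v := by
  induction k generalizing x with
  | zero => exact i.elim0
  | succ k ih =>
    rw [iteratedFDeriv_succ_apply_eq_fderiv hf, iteratedFDeriv_succ_apply_eq_fderiv hf]
    induction i using Fin.cases with
    | zero =>
      have h : ∀ w : Fin (k + 2) → V, fderiv ℝ (fun y => iteratedFDeriv ℝ (k + 1) f y (Fin.tail w))
          x (w 0) = fderiv ℝ (fderiv ℝ (fun y => iteratedFDeriv ℝ k f y (Fin.tail (Fin.tail w))))
          x (w 0) (w 1) := by
        intro w
        have hG : ContDiff ℝ ∞ (fun y => iteratedFDeriv ℝ k f y (Fin.tail (Fin.tail w))) :=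
          (ContinuousMultilinearMap.apply ℝ (fun _ : Fin k => V) F
            (Fin.tail (Fin.tail w))).contDiff.comp
            (hf.iteratedFDeriv_right (m := ∞) (i := k) (by exact_mod_cast le_top))
        simp_rw [iteratedFDeriv_succ_apply_eq_fderiv hf]
        rw [fderiv_clm_apply ((hG.fderiv_right (m := ∞) (by exact_mod_cast le_top)).differentiable
          (by simp)).differentiableAt (differentiableAt_const _)]
        simp [Fin.tail]
      rw [h, h]
      have ht : Fin.tail (Fin.tail (v ∘ Equiv.swap (Fin.castSucc 0) (Fin.succ 0))) =
          Fin.tail (Fin.tail v) := by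
        ext1 j
        simp only [Fin.tail, Function.comp_apply]
        rw [Equiv.swap_apply_of_ne_of_ne (by simp [Fin.ext_iff]) (by simp [Fin.ext_iff])]
      rw [ht]
      have hG : ContDiff ℝ ∞ (fun y => iteratedFDeriv ℝ k f y (Fin.tail (Fin.tail v))) :=
        (ContinuousMultilinearMap.apply ℝ (fun _ : Fin k => V) F
          (Fin.tail (Fin.tail v))).contDiff.comp
          (hf.iteratedFDeriv_right (m := ∞) (i := k) (by exact_mod_cast le_top))
      have := (hG.contDiffAt (x := x)).isSymmSndFDerivAt (by
        rw [minSmoothness_of_isRCLikeNormedField]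
        exact WithTop.coe_le_coe.2 (le_top : (2 : ℕ∞) ≤ ⊤))
      rw [this]
      simp
    | succ j =>
      have h0 : (v ∘ Equiv.swap j.succ.castSucc j.succ.succ) 0 = v 0 := by
        simp only [Function.comp_apply]
        rw [Equiv.swap_apply_of_ne_of_ne (by simp [Fin.ext_iff]) (by simp [Fin.ext_iff])]
      have ht : Fin.tail (v ∘ Equiv.swap j.succ.castSucc j.succ.succ) =
          Fin.tail v ∘ Equiv.swap j.castSucc j.succ := by
        ext1 l
        simp only [Fin.tail, Function.comp_apply]
        congr 1
        rw [← Fin.succ_castSucc]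
        exact ((Fin.succ_injective _).swap_apply _ _ _)
      rw [h0, ht]
      congr 2
      ext1 y
      exact ih j y (Fin.tail v)

/-- Adjacent transpositions generate the symmetric group. -/
theorem iteratedFDeriv_apply_comp_perm (hf : ContDiff ℝ ∞ f) (x : V) {k : ℕ}
    (σ : Equiv.Perm (Fin k)) (v : Fin k → V) :
    iteratedFDeriv ℝ k f x (v ∘ σ) = iteratedFDeriv ℝ k f x v := by
  cases k with
  | zero => congr 1; exact Subsingleton.elim _ _
  | succ k =>
    have hσ : σ ∈ Submonoid.closure
        (Set.range fun i : Fin k => Equiv.swap i.castSucc i.succ) := by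
      rw [Equiv.Perm.mclosure_swap_castSucc_succ]; trivial
    induction hσ using Submonoid.closure_induction generalizing v with
    | mem σ h =>
      obtain ⟨i, rfl⟩ := h
      exact iteratedFDeriv_apply_comp_swap hf k i x v
    | one => rfl
    | mul σ τ _ _ h1 h2 =>
      rw [Equiv.Perm.coe_mul, ← Function.comp_assoc, h2, h1]

theorem iteratedFDeriv_apply_comp_equiv (hf : ContDiff ℝ ∞ f) (x : V) {k l : ℕ}
    (σ : Fin l ≃ Fin k) (d : Fin k → V) :
    iteratedFDeriv ℝ l f x (d ∘ σ) = iteratedFDeriv ℝ k f x d := by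
  obtain rfl : l = k := by simpa using Fintype.card_congr σ
  exact iteratedFDeriv_apply_comp_perm hf x σ d

end

/-- Sorting: `α i` is the size of the fibre of `s` over `i`, and `σ` enumerates the fibres one after
the other. -/
theorem exists_multiIndex_equiv {n : ℕ} {A : Type} [Fintype A] (s : A → Fin n) :
    ∃ (α : Fin n → ℕ) (σ : Fin (order α) ≃ A), ∀ j,
      s (σ j) = (finSigmaFinEquiv.symm j).1 := by
  classical
  refine ⟨fun i => Fintype.card {a // s a = i}, finSigmaFinEquiv.symm.trans
    ((Equiv.sigmaCongrRight fun i => (Fintype.equivFin _).symm).trans (Equiv.sigmaFiberEquiv s)),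
    fun j => ?_⟩
  exact ((Fintype.equivFin {a // s a = (finSigmaFinEquiv.symm j).1}).symm
    (finSigmaFinEquiv.symm j).2).2

theorem exists_equiv_sum {A X Y : Type} [Fintype A] (s : A → X ⊕ Y) :
    ∃ (B C : Type) (_ : Fintype B) (_ : Fintype C) (σ : B ⊕ C ≃ A) (t : B → X) (r : C → Y),
      ∀ j, s (σ j) = Sum.map t r j := by
  classical
  refine ⟨{a // (s a).isLeft}, {a // ¬(s a).isLeft}, inferInstance, inferInstance,
    Equiv.sumCompl _, fun a => (s a).getLeft a.2,
    fun a => (s a).getRight (Sum.not_isLeft.1 a.2), ?_⟩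
  rintro (j | j) <;> simp

/-- The standard basis of `ℝⁿ`. -/
noncomputable def stdBasis (n : ℕ) : Module.Basis (Fin n) ℝ (Rn n) :=
  (EuclideanSpace.basisFun (Fin n) ℝ).toBasis

theorem stdBasis_apply {n : ℕ} (i : Fin n) : stdBasis n i = EuclideanSpace.single i 1 := by
  simp [stdBasis]

theorem abs_stdBasis_repr_le {n : ℕ} (v : Rn n) (j : Fin n) : |(stdBasis n).repr v j| ≤ ‖v‖ := by
  have : (stdBasis n).repr v j = v j := by simp [stdBasis]
  rw [this]
  exact PiLp.norm_apply_le v j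

theorem norm_iteratedFDeriv_le_sum_partialD (n k : ℕ) :
    ∃ α : (Fin k → Fin n) → Fin n → ℕ, ∀ f : Rn n → ℂ, ContDiff ℝ ∞ f → ∀ x,
      ‖iteratedFDeriv ℝ k f x‖ ≤ ∑ s, ‖partialD (α s) f x‖ := by
  choose α σ h using fun s : Fin k → Fin n => exists_multiIndex_equiv s
  refine ⟨α, fun f hf x => ((iteratedFDeriv ℝ k f x).norm_le_sum_basis (stdBasis n)
    abs_stdBasis_repr_le).trans (Finset.sum_le_sum fun s _ => le_of_eq ?_)⟩
  rw [← iteratedFDeriv_apply_comp_equiv hf x (σ s), partialD]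
  congr 2
  ext1 j
  simp only [Function.comp_apply, stdBasis_apply, h, directions]

theorem exists_multiIndex₃_equiv {n k : ℕ} (s : Fin k → Fin n ⊕ (Fin n ⊕ Fin n)) :
    ∃ (α β γ : Fin n → ℕ) (σ : Fin (order α + order β + order γ) ≃ Fin k),
      (fun j => ((stdBasis n).prod ((stdBasis n).prod (stdBasis n))) (s (σ j))) =
      Fin.append
      (Fin.append (fun j => ((0 : Rn n), (0 : Rn n), directions α j))
        (fun j => (directions β j, 0, 0)))
      (fun j => (0, directions γ j, 0)) := by
  obtain ⟨A, A', _, _, τ, t, t', hτ⟩ := exists_equiv_sum s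
  obtain ⟨B, C, _, _, υ, r, q, hυ⟩ := exists_equiv_sum t'
  obtain ⟨β, b, hb⟩ := exists_multiIndex_equiv t
  obtain ⟨γ, c, hc⟩ := exists_multiIndex_equiv r
  obtain ⟨α, a, ha⟩ := exists_multiIndex_equiv q
  -- Basis vectors come in the order `x, y, ξ`, whereas `partialD₃` lists the blocks in the order
  -- `ξ, x, y`.
  let e : (Fin (order α) ⊕ Fin (order β)) ⊕ Fin (order γ) ≃ Fin k :=
    ((Equiv.sumCongr ((Equiv.sumCongr a b).trans (Equiv.sumComm _ _)) c).trans
      ((Equiv.sumAssoc A C B).trans (Equiv.sumCongr (Equiv.refl _) (Equiv.sumComm _ _)))).trans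
      ((Equiv.sumCongr (Equiv.refl _) υ).trans τ)
  refine ⟨α, β, γ, (finSumFinEquiv.symm.trans
    (Equiv.sumCongr finSumFinEquiv.symm (Equiv.refl _))).trans e, ?_⟩
  ext1 j
  induction j using Fin.addCases with
  | left j =>
    induction j using Fin.addCases with
    | left j => simp [e, hτ, hυ, ha, stdBasis_apply, directions]
    | right j => simp [e, hτ, hb, stdBasis_apply, directions, Prod.mk_zero_zero]
  | right j => simp [e, hτ, hυ, hc, stdBasis_apply, directions]

theorem norm_iteratedFDeriv_le_sum_partialD₃ (n k : ℕ) :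
    ∃ α β γ : (Fin k → Fin n ⊕ (Fin n ⊕ Fin n)) → Fin n → ℕ,
      ∀ f : Rn n × Rn n × Rn n → ℂ, ContDiff ℝ ∞ f → ∀ x,
        ‖iteratedFDeriv ℝ k f x‖ ≤ ∑ s, ‖partialD₃ (α s) (β s) (γ s) f x‖ := by
  choose α β γ σ h using fun s : Fin k → Fin n ⊕ (Fin n ⊕ Fin n) => exists_multiIndex₃_equiv s
  refine ⟨α, β, γ, fun f hf x => ((iteratedFDeriv ℝ k f x).norm_le_sum_basis
    ((stdBasis n).prod ((stdBasis n).prod (stdBasis n))) ?_).trans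
    (Finset.sum_le_sum fun s _ => le_of_eq ?_)⟩
  · rintro ⟨v, w, z⟩ (j | j | j)
    · simpa using Or.inl (abs_stdBasis_repr_le v j)
    · simpa using Or.inr (Or.inl (abs_stdBasis_repr_le w j))
    · simpa using Or.inr (Or.inr (abs_stdBasis_repr_le z j))
  · rw [← iteratedFDeriv_apply_comp_equiv hf x (σ s), partialD₃, ← h]
    rfl

theorem norm_partialD_le {n : ℕ} (α : Fin n → ℕ) (f : Rn n → ℂ) (x : Rn n) :
    ‖partialD α f x‖ ≤ ‖iteratedFDeriv ℝ (order α) f x‖ := by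
  refine ((iteratedFDeriv ℝ (order α) f x).le_opNorm _).trans (le_of_eq ?_)
  simp [directions]

/-! ### Moderate and negligible dependence on the parameter -/

/-- Functions of `ε` of at most polynomial growth in `ε⁻¹`. -/
def moderate : Submodule ℝ (Param → ℝ) where
  carrier := {C | ∃ (N : ℕ) (c : ℝ), ∀ ε : Param, |C ε| ≤ c * ((ε : ℝ) ^ N)⁻¹}
  zero_mem' := ⟨0, 0, fun ε => by simp⟩
  add_mem' := by
    rintro C D ⟨N, c, hc⟩ ⟨M, d, hd⟩
    have key : ∀ (N M : ℕ) (c : ℝ) (ε : Param), c * ((ε : ℝ) ^ N)⁻¹ ≤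
        |c| * ((ε : ℝ) ^ (N + M))⁻¹ := fun N M c ε => by
      have h0 : (0 : ℝ) < ε := ε.2.1
      refine mul_le_mul (le_abs_self c) (inv_anti₀ (by positivity)
        (pow_le_pow_of_le_one h0.le ε.2.2 (Nat.le_add_right _ _))) (by positivity) (abs_nonneg c)
    refine ⟨N + M, |c| + |d|, fun ε => (abs_add_le _ _).trans ?_⟩
    rw [add_mul]
    refine add_le_add ((hc ε).trans (key N M c ε)) ((hd ε).trans ?_)
    rw [add_comm N M]
    exact key M N d ε
  smul_mem' := by
    rintro r C ⟨N, c, hc⟩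
    refine ⟨N, |r| * c, fun ε => ?_⟩
    rw [Pi.smul_apply, smul_eq_mul, abs_mul, mul_assoc]
    exact mul_le_mul_of_nonneg_left (hc ε) (abs_nonneg r)

/-- Functions of `ε` which are `O(ε ^ q)` for every `q`. -/
def negligible : Submodule ℝ (Param → ℝ) where
  carrier := {C | ∀ q : ℕ, ∃ c : ℝ, ∀ ε : Param, |C ε| ≤ c * (ε : ℝ) ^ q}
  zero_mem' := fun q => ⟨0, fun ε => by simp⟩
  add_mem' := by
    intro C D hC hD q
    obtain ⟨c, hc⟩ := hC q
    obtain ⟨d, hd⟩ := hD q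
    refine ⟨c + d, fun ε => (abs_add_le _ _).trans ?_⟩
    rw [add_mul]
    exact add_le_add (hc ε) (hd ε)
  smul_mem' := by
    intro r C hC q
    obtain ⟨c, hc⟩ := hC q
    refine ⟨|r| * c, fun ε => ?_⟩
    rw [Pi.smul_apply, smul_eq_mul, abs_mul, mul_assoc]
    exact mul_le_mul_of_nonneg_left (hc ε) (abs_nonneg r)

theorem moderate_mul {C D : Param → ℝ} (hC : C ∈ moderate) (hD : D ∈ moderate) :
    C * D ∈ moderate := by
  obtain ⟨N, c, hc⟩ := hC
  obtain ⟨M, d, hd⟩ := hD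
  refine ⟨N + M, c * d, fun ε => ?_⟩
  rw [Pi.mul_apply, abs_mul, pow_add, mul_inv, mul_mul_mul_comm]
  exact mul_le_mul (hc ε) (hd ε) (abs_nonneg _) ((abs_nonneg _).trans (hc ε))

theorem moderate_mul_negligible {C D : Param → ℝ} (hC : C ∈ moderate) (hD : D ∈ negligible) :
    C * D ∈ negligible := by
  intro q
  obtain ⟨N, c, hc⟩ := hC
  obtain ⟨d, hd⟩ := hD (N + q)
  refine ⟨c * d, fun ε => ?_⟩
  have h0 : (ε : ℝ) ≠ 0 := ε.2.1.ne'
  rw [Pi.mul_apply, abs_mul]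
  refine (mul_le_mul (hc ε) (hd ε) (abs_nonneg _) ((abs_nonneg _).trans (hc ε))).trans
    (le_of_eq ?_)
  rw [pow_add]
  field_simp

theorem const_mul_inv_pow_mem_moderate (c : ℝ) (N : ℕ) :
    (fun ε : Param => c * ((ε : ℝ) ^ N)⁻¹) ∈ moderate :=
  ⟨N, |c|, fun ε => by
    have h0 : (0 : ℝ) < ε := ε.2.1
    rw [abs_mul, abs_of_pos (a := ((ε : ℝ) ^ N)⁻¹) (by positivity)]⟩

/-- Turns one estimate for each `q` into a single negligible constant, the infimum over `q` of `c q
* ε ^ q`. Positivity of `W` allows dividing by it to pass to the infimum. -/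
theorem exists_negligible_bound {E : Type} {X : Param → E → ℝ} {W : E → ℝ}
    (hW : ∀ p, 0 < W p) (h : ∀ q : ℕ, ∃ c : ℝ, 0 ≤ c ∧ ∀ ε p, X ε p ≤ c * (ε : ℝ) ^ q * W p) :
    ∃ C ∈ negligible, 0 ≤ C ∧ ∀ ε p, X ε p ≤ C ε * W p := by
  choose c hc0 hc using h
  have hpos : ∀ (ε : Param) q, 0 ≤ c q * (ε : ℝ) ^ q := fun ε q =>
    mul_nonneg (hc0 q) (pow_nonneg ε.2.1.le _)
  have hbdd : ∀ ε : Param, BddBelow (Set.range fun q => c q * (ε : ℝ) ^ q) := fun ε =>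
    ⟨0, by rintro _ ⟨q, rfl⟩; exact hpos ε q⟩
  have h0 : ∀ ε : Param, 0 ≤ ⨅ q, c q * (ε : ℝ) ^ q := fun ε => le_ciInf (hpos ε)
  refine ⟨fun ε => ⨅ q, c q * (ε : ℝ) ^ q, fun q => ⟨c q, fun ε => ?_⟩, h0, fun ε p => ?_⟩
  · rw [abs_of_nonneg (h0 ε)]
    exact ciInf_le (hbdd ε) q
  · rw [← div_le_iff₀ (hW p)]
    exact le_ciInf fun q => (div_le_iff₀ (hW p)).2 (hc q ε p)

/-! ### Amplitudes -/

theorem one_le_japanese {V : Type} [NormedAddCommGroup V] (x : V) : 1 ≤ japanese x :=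
  Real.one_le_sqrt.2 (by nlinarith [sq_nonneg ‖x‖])

theorem japanese_le {V : Type} [NormedAddCommGroup V] (x : V) : japanese x ≤ 1 + ‖x‖ := by
  refine Real.sqrt_le_iff.2 ⟨by positivity, ?_⟩
  nlinarith [norm_nonneg x]

theorem japanese_rpow_le {V : Type} [NormedAddCommGroup V] (x : V) (s : ℝ) :
    japanese x ^ s ≤ (1 + ‖x‖) ^ ⌈|s|⌉₊ := by
  have h1 := one_le_japanese x
  calc japanese x ^ s ≤ japanese x ^ ((⌈|s|⌉₊ : ℕ) : ℝ) :=
        Real.rpow_le_rpow_of_exponent_le h1 ((le_abs_self s).trans (Nat.le_ceil _))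
    _ = japanese x ^ ⌈|s|⌉₊ := Real.rpow_natCast _ _
    _ ≤ _ := pow_le_pow_left₀ (by linarith) (japanese_le x) _

/-- For `m ≥ 0` the upper bound by `⟨z⟩` is raised to the power `m`. For `m < 0` it is enough that
`Λ` is bounded away from zero, which follows from `1 ≤ ⟨z⟩^μ ≤ c₁ Λ(z)`. -/
theorem Colombeau.IsWeight.exists_rpow_le {n : ℕ} {Λ : R2n n → ℝ} (hΛ : IsWeight Λ) (m : ℝ) :
    ∃ c : ℝ, 0 ≤ c ∧ (∀ z, 0 < Λ z) ∧ ∀ z, Λ z ^ m ≤ c * (1 + ‖z‖) ^ ⌈|m|⌉₊ := by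
  obtain ⟨μ, hμ, ⟨c₁, hc₁, h₁⟩, ⟨c₂, hc₂, h₂⟩, -, -⟩ := hΛ.bounds
  have hlow : ∀ z, c₁⁻¹ ≤ Λ z := fun z => by
    have := (Real.one_le_rpow (one_le_japanese z) hμ.le).trans (h₁ z)
    rw [inv_le_iff_one_le_mul₀ hc₁]
    linarith
  have hpos : ∀ z, 0 < Λ z := fun z => (inv_pos.2 hc₁).trans_le (hlow z)
  refine ⟨c₂ ^ m + c₁⁻¹ ^ m, by positivity, hpos, fun z => ?_⟩
  have hz : 1 ≤ (1 + ‖z‖) ^ ⌈|m|⌉₊ := one_le_pow₀ (by linarith [norm_nonneg z])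
  have p1 : 0 ≤ c₁⁻¹ ^ m := by positivity
  have p2 : 0 ≤ c₂ ^ m := by positivity
  rcases le_or_gt 0 m with hm | hm
  · calc Λ z ^ m ≤ (c₂ * japanese z) ^ m := Real.rpow_le_rpow (hpos z).le (h₂ z) hm
      _ = c₂ ^ m * japanese z ^ m :=
        Real.mul_rpow hc₂.le (zero_le_one.trans (one_le_japanese z))
      _ ≤ c₂ ^ m * (1 + ‖z‖) ^ ⌈|m|⌉₊ :=
        mul_le_mul_of_nonneg_left (japanese_rpow_le z m) p2
      _ ≤ _ := mul_le_mul_of_nonneg_right (by linarith) (by positivity)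
  · calc Λ z ^ m ≤ c₁⁻¹ ^ m :=
        Real.rpow_le_rpow_of_nonpos (inv_pos.2 hc₁) (hlow z) hm.le
      _ ≤ c₂ ^ m + c₁⁻¹ ^ m := by linarith
      _ ≤ _ := le_mul_of_one_le_right (by linarith) hz

/-- The polynomial weight dominating all amplitude weights. -/
noncomputable def polyWeight {n : ℕ} (r : ℕ) (p : Rn n × Rn n × Rn n) : ℝ :=
  (1 + ‖p.1‖) ^ r * (1 + ‖p.2.2‖) ^ r * (1 + ‖p.2.1‖) ^ r

theorem polyWeight_pos {n : ℕ} (r : ℕ) (p : Rn n × Rn n × Rn n) : 0 < polyWeight r p := by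
  unfold polyWeight; positivity

/-- The factor depending on `k` has base at least 1 and exponent at most 0, so it is dropped. Hence
`c` and `r` are independent of the order of differentiation. -/
theorem Colombeau.IsWeight.amplitudeWeight_le {n : ℕ} {Λ : R2n n → ℝ} (hΛ : IsWeight Λ) {ρ : ℝ}
    (hρ : 0 ≤ ρ) (m m' : ℝ) :
    ∃ (c : ℝ) (r : ℕ), 0 ≤ c ∧ ∀ (k : ℕ) (x y ξ : Rn n),
      amplitudeWeight Λ ρ m m' k x y ξ ≤ c * polyWeight r (x, y, ξ) := by
  obtain ⟨c, hc, hpos, h⟩ := hΛ.exists_rpow_le m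
  refine ⟨c, ⌈|m|⌉₊ + ⌈|m'|⌉₊, hc, fun k x y ξ => ?_⟩
  have e0 : 0 < Λ (WithLp.toLp 2 (x, ξ)) := hpos _
  have ej : 0 < japanese (x - y) := zero_lt_one.trans_le (one_le_japanese _)
  have e1 : (1 + Λ (WithLp.toLp 2 (x, ξ)) * japanese (x - y) ^ (-m')) ^ (-(ρ * k)) ≤ 1 := by
    refine Real.rpow_le_one_of_one_le_of_nonpos ?_ ?_
    · have : 0 ≤ Λ (WithLp.toLp 2 (x, ξ)) * japanese (x - y) ^ (-m') := by positivity
      linarith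
    · have : 0 ≤ ρ * k := by positivity
      linarith
  have hx := norm_nonneg x
  have hy := norm_nonneg y
  have hξ := norm_nonneg ξ
  have e2 : 1 + ‖(WithLp.toLp 2 (x, ξ) : R2n n)‖ ≤ (1 + ‖x‖) * (1 + ‖ξ‖) := by
    have : ‖(WithLp.toLp 2 (x, ξ) : R2n n)‖ ≤ ‖x‖ + ‖ξ‖ := by
      rw [WithLp.prod_norm_eq_of_L2]
      refine Real.sqrt_le_iff.2 ⟨by positivity, ?_⟩
      change ‖x‖ ^ 2 + ‖ξ‖ ^ 2 ≤ _
      nlinarith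
    nlinarith
  have e3 : 1 + ‖x - y‖ ≤ (1 + ‖x‖) * (1 + ‖y‖) := by
    nlinarith [norm_sub_le x y]
  have e4 := (h (WithLp.toLp 2 (x, ξ))).trans
    (mul_le_mul_of_nonneg_left (pow_le_pow_left₀ (by positivity) e2 _) hc)
  have e5 := (japanese_rpow_le (x - y) m').trans (pow_le_pow_left₀ (by positivity) e3 _)
  have mono : ∀ (t : ℝ), 0 ≤ t → ∀ a b : ℕ, (1 + t) ^ a ≤ (1 + t) ^ (a + b) := fun t ht a b =>
    pow_le_pow_right₀ (by linarith) (Nat.le_add_right _ _)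
  calc amplitudeWeight Λ ρ m m' k x y ξ
      ≤ Λ (WithLp.toLp 2 (x, ξ)) ^ m * japanese (x - y) ^ m' :=
        mul_le_of_le_one_right (by positivity) e1
    _ ≤ c * ((1 + ‖x‖) * (1 + ‖ξ‖)) ^ ⌈|m|⌉₊ * ((1 + ‖x‖) * (1 + ‖y‖)) ^ ⌈|m'|⌉₊ :=
        mul_le_mul e4 e5 (by positivity) (by positivity)
    _ = c * ((1 + ‖x‖) ^ (⌈|m|⌉₊ + ⌈|m'|⌉₊) * (1 + ‖ξ‖) ^ ⌈|m|⌉₊ * (1 + ‖y‖) ^ ⌈|m'|⌉₊) := by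
        rw [mul_pow, mul_pow, pow_add]; ring
    _ ≤ _ := by
        unfold polyWeight
        simp only
        gcongr
        · linarith
        · omega
        · linarith
        · omega

theorem derivBound_of_partialD₃ {n : ℕ} {T : Submodule ℝ (Param → ℝ)}
    {W : Rn n × Rn n × Rn n → ℝ} {a : Net (Rn n × Rn n × Rn n)}
    (ha : ∀ ε, ContDiff ℝ ∞ (a ε)) (h : ∀ α β γ : Fin n → ℕ, ∃ C ∈ T, 0 ≤ C ∧
      ∀ ε p, ‖partialD₃ α β γ (a ε) p‖ ≤ C ε * W p) : DerivBound T W a := by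
  refine ⟨ha, fun k => ?_⟩
  obtain ⟨α, β, γ, H⟩ := norm_iteratedFDeriv_le_sum_partialD₃ n k
  choose C hC hC0 hb using fun s => h (α s) (β s) (γ s)
  refine ⟨∑ s, C s, T.sum_mem fun s _ => hC s, Finset.sum_nonneg fun s _ => hC0 s,
    fun ε p => (H (a ε) (ha ε) p).trans ?_⟩
  rw [Finset.sum_apply, Finset.sum_mul]
  exact Finset.sum_le_sum fun s _ => hb s ε p

theorem Colombeau.Amplitude.derivBound {n : ℕ} {Λ : R2n n → ℝ} (hΛ : IsWeight Λ) {m ρ : ℝ}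
    (hρ : 0 ≤ ρ) {a : Net (Rn n × Rn n × Rn n)} (ha : a ∈ Amplitude Λ m ρ) :
    ∃ r, DerivBound moderate (polyWeight r) a := by
  obtain ⟨hs, m', h⟩ := ha
  obtain ⟨c, r, hc, hw⟩ := hΛ.amplitudeWeight_le hρ m m'
  refine ⟨r, derivBound_of_partialD₃ hs fun α β γ => ?_⟩
  obtain ⟨N, d, hd, hb⟩ := h α β γ
  refine ⟨_, const_mul_inv_pow_mem_moderate (d * c) N, fun ε => ?_, fun ε p => ?_⟩
  · have : (0 : ℝ) < ε := ε.2.1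
    positivity
  · refine (hb ε p.1 p.2.1 p.2.2).trans ?_
    have hε : (0 : ℝ) < ε := ε.2.1
    have := mul_le_mul_of_nonneg_left (hw (order (α + β + γ)) p.1 p.2.1 p.2.2)
      (show 0 ≤ d * ((ε : ℝ) ^ N)⁻¹ by positivity)
    calc _ = d * ((ε : ℝ) ^ N)⁻¹ *
          amplitudeWeight Λ ρ m m' (order (α + β + γ)) p.1 p.2.1 p.2.2 := by ring
      _ ≤ _ := this
      _ = _ := by ring

theorem Colombeau.NegligibleAmplitude.derivBound {n : ℕ} {Λ : R2n n → ℝ} (hΛ : IsWeight Λ) {m ρ : ℝ}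
    (hρ : 0 ≤ ρ) {a : Net (Rn n × Rn n × Rn n)} (ha : a ∈ NegligibleAmplitude Λ m ρ) :
    ∃ r, DerivBound negligible (polyWeight r) a := by
  obtain ⟨⟨hs, -⟩, m', h⟩ := ha
  obtain ⟨c, r, hc, hw⟩ := hΛ.amplitudeWeight_le hρ m m'
  refine ⟨r, derivBound_of_partialD₃ hs fun α β γ => exists_negligible_bound
    (polyWeight_pos r) fun q => ?_⟩
  obtain ⟨d, hd, hb⟩ := h α β γ q
  refine ⟨d * c, by positivity, fun ε p => (hb ε p.1 p.2.1 p.2.2).trans ?_⟩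
  have hε : (0 : ℝ) < ε := ε.2.1
  have := mul_le_mul_of_nonneg_left (hw (order (α + β + γ)) p.1 p.2.1 p.2.2)
    (show 0 ≤ d * (ε : ℝ) ^ q by positivity)
  calc _ = d * (ε : ℝ) ^ q *
        amplitudeWeight Λ ρ m m' (order (α + β + γ)) p.1 p.2.1 p.2.2 := by ring
    _ ≤ _ := this
    _ = _ := by ring

/-! ### Nets of functions and the regularizing factor -/

/-- Smooth nets all of whose derivatives grow at most polynomially, with an exponent depending on
the derivative, and depend on `ε` as prescribed by `T`. -/
def PolyBound {n : ℕ} (T : Submodule ℝ (Param → ℝ)) (u : Net (Rn n)) : Prop :=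
  (∀ ε, ContDiff ℝ ∞ (u ε)) ∧ ∀ k : ℕ, ∃ N : ℕ, ∃ C ∈ T, 0 ≤ C ∧
    ∀ ε x, ‖iteratedFDeriv ℝ k (u ε) x‖ ≤ C ε * (1 + ‖x‖) ^ N

theorem polyBound_of_partialD {n : ℕ} {T : Submodule ℝ (Param → ℝ)} {u : Net (Rn n)}
    (hu : ∀ ε, ContDiff ℝ ∞ (u ε)) (h : ∀ α : Fin n → ℕ, ∃ N : ℕ, ∃ C ∈ T, 0 ≤ C ∧
      ∀ ε x, ‖partialD α (u ε) x‖ ≤ C ε * (1 + ‖x‖) ^ N) : PolyBound T u := by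
  refine ⟨hu, fun k => ?_⟩
  obtain ⟨α, H⟩ := norm_iteratedFDeriv_le_sum_partialD n k
  choose N C hC hC0 hb using fun s => h (α s)
  refine ⟨∑ s, N s, ∑ s, C s, T.sum_mem fun s _ => hC s, Finset.sum_nonneg fun s _ => hC0 s,
    fun ε x => (H (u ε) (hu ε) x).trans ?_⟩
  rw [Finset.sum_apply, Finset.sum_mul]
  refine Finset.sum_le_sum fun s _ => (hb s ε x).trans (mul_le_mul_of_nonneg_left ?_ (hC0 s ε))
  exact pow_le_pow_right₀ (by linarith [norm_nonneg x])
    (Finset.single_le_sum (f := N) (fun _ _ => Nat.zero_le _) (Finset.mem_univ s))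

theorem Colombeau.ETau.polyBound {n : ℕ} {u : Net (Rn n)} (hu : u ∈ ETau n) :
    PolyBound moderate u := by
  refine polyBound_of_partialD hu.1 fun α => ?_
  obtain ⟨N, C, h⟩ := hu.2 α
  refine ⟨N, _, const_mul_inv_pow_mem_moderate |C| N, fun ε => ?_, fun ε x => ?_⟩
  · have : (0 : ℝ) < ε := ε.2.1
    positivity
  · have hε : (0 : ℝ) < ε := ε.2.1
    have hj : 0 < japanese x := zero_lt_one.trans_le (one_le_japanese x)
    have hC := (h ε x).trans (le_abs_self C)
    have e : ‖partialD α (u ε) x‖ = (ε : ℝ) ^ N * ((japanese x ^ N)⁻¹ * ‖partialD α (u ε) x‖) *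
        (((ε : ℝ) ^ N)⁻¹ * japanese x ^ N) := by field_simp
    rw [e, mul_assoc |C|]
    refine mul_le_mul hC (mul_le_mul_of_nonneg_left (pow_le_pow_left₀ hj.le (japanese_le x) _)
      (by positivity)) (by positivity) (abs_nonneg C)

theorem Colombeau.NS.polyBound {n : ℕ} {u : Net (Rn n)} (hu : u ∈ NS n) :
    PolyBound negligible u := by
  refine polyBound_of_partialD hu.1 fun α => ⟨0, exists_negligible_bound (by simp) fun q => ?_⟩
  -- The trivial monomial is enough: decay in `x` will be supplied by the regularizing factor.
  obtain ⟨C, h⟩ := hu.2 0 α q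
  refine ⟨|C|, abs_nonneg C, fun ε x => ?_⟩
  have hε : (0 : ℝ) < ε := ε.2.1
  have := (h ε x).trans (le_abs_self C)
  simp only [monomial, Pi.zero_apply, pow_zero, Finset.prod_const_one, Complex.ofReal_one,
    one_mul] at this
  rw [inv_mul_le_iff₀ (by positivity)] at this
  rw [pow_zero, mul_one]
  linarith

/-! ### Rapid decay of the regularizing factor -/

theorem SchwartzMap.exists_norm_iteratedFDeriv_le {V : Type} [NormedAddCommGroup V]
    [NormedSpace ℝ V] (f : SchwartzMap V ℂ) (k K : ℕ) :
    ∃ C : ℝ, 0 ≤ C ∧ ∀ x, ‖iteratedFDeriv ℝ k f x‖ ≤ C * ((1 + ‖x‖) ^ K)⁻¹ := by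
  have H := SchwartzMap.one_add_le_sup_seminorm_apply (𝕜 := ℝ) (m := (K, k)) le_rfl le_rfl f
  refine ⟨_, le_trans (by positivity) (H 0), fun x => ?_⟩
  rw [← div_eq_mul_inv, le_div_iff₀ (by positivity), mul_comm]
  exact H x

theorem norm_iteratedFDeriv_comp_smul_le {V F : Type} [NormedAddCommGroup V] [NormedSpace ℝ V]
    [NormedAddCommGroup F] [NormedSpace ℝ F] {f : V → F} (hf : ContDiff ℝ ∞ f) {t : ℝ}
    (ht : |t| ≤ 1) (k : ℕ) (x : V) :
    ‖iteratedFDeriv ℝ k (fun y => f (t • y)) x‖ ≤ ‖iteratedFDeriv ℝ k f (t • x)‖ := by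
  have h := (t • ContinuousLinearMap.id ℝ V).iteratedFDeriv_comp_right hf x (i := k)
    (by exact_mod_cast le_top)
  change ‖iteratedFDeriv ℝ k (f ∘ (t • ContinuousLinearMap.id ℝ V)) x‖ ≤ _
  rw [h]
  refine (ContinuousMultilinearMap.norm_compContinuousLinearMap_le _ _).trans
    (mul_le_of_le_one_right (norm_nonneg _) (Finset.prod_le_one (fun _ _ => norm_nonneg _) ?_))
  intro _ _
  refine ContinuousLinearMap.opNorm_le_bound _ zero_le_one fun y => ?_
  simp only [smul_apply, ContinuousLinearMap.id_apply, norm_smul, Real.norm_eq_abs]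
  exact mul_le_mul_of_nonneg_right ht (norm_nonneg _)

/-- Substituting `x = εx'` cancels `ε^(-n)`; the division by `2π` converts between the two
normalizations of the Fourier transform. -/
theorem hat_scaled {n : ℕ} (φ : SchwartzMap (Rn n) ℂ) (ε : Param) (y : Rn n) :
    hat (scaled φ ε) y = (𝓕 φ) (((ε : ℝ) / (2 * Real.pi)) • y) := by
  have hε : (0 : ℝ) < ε := ε.2.1
  have h := Measure.integral_comp_inv_smul_of_nonneg (volume : Measure (Rn n))
    (fun x => Complex.exp (-Complex.I * (inner ℝ ((ε : ℝ) • x) y : ℝ)) * φ x) hε.le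
  rw [finrank_euclideanSpace_fin] at h
  have e : hat (scaled φ ε) y = ((((ε : ℝ) ^ n)⁻¹ : ℝ) : ℂ) * ∫ x,
      Complex.exp (-Complex.I * (inner ℝ ((ε : ℝ) • ((ε : ℝ)⁻¹ • x)) y : ℝ)) *
        φ ((ε : ℝ)⁻¹ • x) := by
    rw [hat, ← integral_const_mul]
    congr 1
    ext x
    rw [scaled, smul_inv_smul₀ hε.ne']
    ring
  rw [e, h, Complex.real_smul, ← mul_assoc, ← Complex.ofReal_mul,
    inv_mul_cancel₀ (by positivity), Complex.ofReal_one, one_mul, SchwartzMap.fourier_coe,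
    Real.fourier_eq']
  congr 1
  ext x
  rw [smul_eq_mul, real_inner_smul_left, real_inner_smul_right]
  congr 2
  push_cast
  have : (Real.pi : ℂ) ≠ 0 := by exact_mod_cast Real.pi_ne_zero
  field_simp

theorem derivBound_hat_scaled {n : ℕ} (φ : SchwartzMap (Rn n) ℂ) (K : ℕ) :
    DerivBound moderate (fun y : Rn n => ((1 + ‖y‖) ^ K)⁻¹)
      (fun ε : Param => hat (scaled φ ε)) := by
  have e : ∀ ε : Param, hat (scaled φ ε) = fun y =>
      (𝓕 φ : SchwartzMap (Rn n) ℂ) (((ε : ℝ) / (2 * Real.pi)) • y) :=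
    fun ε => funext (hat_scaled φ ε)
  have hs : ContDiff ℝ ∞ (𝓕 φ : SchwartzMap (Rn n) ℂ) := SchwartzMap.smooth _ _
  refine ⟨fun ε => ?_, fun k => ?_⟩
  · simp only [e]
    exact hs.comp (contDiff_const_smul _)
  · obtain ⟨C, hC, h⟩ := (𝓕 φ : SchwartzMap (Rn n) ℂ).exists_norm_iteratedFDeriv_le k K
    refine ⟨_, const_mul_inv_pow_mem_moderate (C * (2 * Real.pi) ^ K) K, fun ε => ?_,
      fun ε y => ?_⟩
    · have : (0 : ℝ) < ε := ε.2.1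
      positivity
    · have hε : (0 : ℝ) < ε := ε.2.1
      have hε1 : (ε : ℝ) ≤ 1 := ε.2.2
      have hπ : 1 ≤ 2 * Real.pi := by linarith [Real.pi_gt_three]
      have ht0 : 0 < (ε : ℝ) / (2 * Real.pi) := by positivity
      have ht1 : (ε : ℝ) / (2 * Real.pi) ≤ 1 := by
        rw [div_le_one (by positivity)]; linarith
      simp only [e]
      refine (norm_iteratedFDeriv_comp_smul_le hs (by rwa [abs_of_pos ht0]) k y).trans
        ((h _).trans ?_)
      -- Decay in `εy/2π` becomes decay in `y` at the price of `(2π/ε)^K`, which is moderate.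
      have h1 : (ε : ℝ) / (2 * Real.pi) * (1 + ‖y‖) ≤ 1 + ‖((ε : ℝ) / (2 * Real.pi)) • y‖ := by
        rw [norm_smul, Real.norm_of_nonneg ht0.le]; linarith
      calc C * ((1 + ‖((ε : ℝ) / (2 * Real.pi)) • y‖) ^ K)⁻¹
          ≤ C * (((ε : ℝ) / (2 * Real.pi) * (1 + ‖y‖)) ^ K)⁻¹ := by gcongr
        _ = _ := by rw [mul_pow, div_pow]; field_simp

/-- The growth exponent `N j` of the `j`-th derivative of `u` depends on `j`. In each Leibniz term
it is compensated by the decay of order `K + N j` of the other factor, so the product has one weight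
for all orders. -/
theorem PolyBound.mul_hat_scaled {n : ℕ} {T : Submodule ℝ (Param → ℝ)}
    (hT : ∀ C ∈ moderate, ∀ D ∈ T, C * D ∈ T) {u : Net (Rn n)} (hu : PolyBound T u)
    (φ : SchwartzMap (Rn n) ℂ) (K : ℕ) :
    DerivBound T (fun y : Rn n => ((1 + ‖y‖) ^ K)⁻¹)
      (fun ε y => u ε y * hat (scaled φ ε) y) := by
  have hφ := fun j => (derivBound_hat_scaled φ j)
  refine ⟨fun ε => (hu.1 ε).mul ((hφ 0).1 ε), fun k => ?_⟩
  choose N C hC hC0 h using hu.2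
  choose D hD hD0 h' using fun j => (hφ j).2
  refine ⟨∑ j ∈ Finset.range (k + 1), (k.choose j : ℝ) • (D (K + N j) (k - j) * C j),
    T.sum_mem fun j _ => T.smul_mem _ (hT _ (hD _ _) _ (hC _)),
    Finset.sum_nonneg fun j _ => smul_nonneg (Nat.cast_nonneg _) (mul_nonneg (hD0 _ _) (hC0 _)),
    fun ε y => (norm_iteratedFDeriv_mul_le (hu.1 ε) ((hφ 0).1 ε) y
      (by exact_mod_cast le_top)).trans ?_⟩
  simp only [Finset.sum_apply, Finset.sum_mul]
  refine Finset.sum_le_sum fun j _ => ?_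
  simp only [Pi.smul_apply, Pi.mul_apply, smul_eq_mul, mul_assoc]
  refine mul_le_mul_of_nonneg_left ?_ (Nat.cast_nonneg _)
  have hy : 0 < 1 + ‖y‖ := by positivity
  refine (mul_le_mul (h j ε y) (h' (K + N j) (k - j) ε y) (norm_nonneg _)
    ((norm_nonneg _).trans (h j ε y))).trans (le_of_eq ?_)
  simp only [pow_add]
  field_simp

/-! ### The full amplitude -/

/-- The permutation of the variables `((x, ξ), y) ↦ (x, y, ξ)`. -/
noncomputable def permuteVars (n : ℕ) : (Rn n × Rn n) × Rn n →L[ℝ] Rn n × Rn n × Rn n :=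
  ((ContinuousLinearMap.fst ℝ _ _).comp (ContinuousLinearMap.fst ℝ _ _)).prod
    ((ContinuousLinearMap.snd ℝ _ _).prod
      ((ContinuousLinearMap.snd ℝ _ _).comp (ContinuousLinearMap.fst ℝ _ _)))

/-- The full amplitude `a(x, y, ξ) u(y) φ̂_ε(y)` as a function of `((x, ξ), y)`. -/
noncomputable def fullAmplitude {n : ℕ} (φ : SchwartzMap (Rn n) ℂ) (a : Net (Rn n × Rn n × Rn n))
    (u : Net (Rn n)) (ε : Param) (p : (Rn n × Rn n) × Rn n) : ℂ :=
  a ε (p.1.1, p.2, p.1.2) * (u ε p.2 * hat (scaled φ ε) p.2)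

theorem derivBound_fullAmplitude {n : ℕ} {T₁ T₂ T : Submodule ℝ (Param → ℝ)}
    (hT₂ : ∀ C ∈ moderate, ∀ D ∈ T₂, C * D ∈ T₂) (hT : ∀ C ∈ T₁, ∀ D ∈ T₂, C * D ∈ T)
    (φ : SchwartzMap (Rn n) ℂ) {a : Net (Rn n × Rn n × Rn n)} {r : ℕ}
    (ha : DerivBound T₁ (polyWeight r) a) {u : Net (Rn n)} (hu : PolyBound T₂ u) (K : ℕ) :
    DerivBound T (fun p : (Rn n × Rn n) × Rn n =>
      (1 + ‖p.1.1‖) ^ r * (1 + ‖p.1.2‖) ^ r * ((1 + ‖p.2‖) ^ K)⁻¹) (fullAmplitude φ a u) := by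
  have h1 := ha.comp_clm (permuteVars n)
  -- The extra order `r` absorbs the growth of the amplitude in `y`.
  have h2 := (hu.mul_hat_scaled hT₂ φ (K + r)).comp_clm
    (ContinuousLinearMap.snd ℝ (Rn n × Rn n) (Rn n))
  refine (h1.bilinear h2 hT (ContinuousLinearMap.mul ℝ ℂ)).mono 1 zero_le_one
    fun p => le_of_eq ?_
  have : 0 < 1 + ‖p.2‖ := by positivity
  simp only [polyWeight, permuteVars, ContinuousLinearMap.prod_apply,
    ContinuousLinearMap.comp_apply, ContinuousLinearMap.coe_fst', ContinuousLinearMap.coe_snd',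
    pow_add]
  field_simp

/-! ### Existence and evaluation of the oscillatory integral -/

theorem const_mem_span_one {ι : Type} (c : ℝ) : (fun _ : ι => c) ∈ Submodule.span ℝ {(1 : ι → ℝ)} :=
  Submodule.mem_span_singleton.2 ⟨c, by ext; simp⟩

theorem mul_mem_span_one {ι : Type} {C D : ι → ℝ} (hC : C ∈ Submodule.span ℝ {(1 : ι → ℝ)})
    (hD : D ∈ Submodule.span ℝ {(1 : ι → ℝ)}) : C * D ∈ Submodule.span ℝ {(1 : ι → ℝ)} := by
  obtain ⟨c, rfl⟩ := Submodule.mem_span_singleton.1 hC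
  rw [smul_mul_assoc, one_mul]
  exact Submodule.smul_mem _ c hD

/-- For `h ≤ 1` the chain rule only produces factors at most one. The span of `1` as space of
constants expresses uniformity in `h`, for which the type `Param` is reused. -/
theorem derivBound_dilate {V : Type} [NormedAddCommGroup V] [NormedSpace ℝ V]
    (ψ : SchwartzMap V ℂ) :
    DerivBound (Submodule.span ℝ {(1 : Param → ℝ)}) (fun _ : V => 1)
      (fun (h : Param) z => ψ ((h : ℝ) • z)) := by
  refine ⟨fun h => ψ.smooth _ |>.comp (contDiff_const_smul _), fun k => ?_⟩
  obtain ⟨C, hC, hb⟩ := ψ.exists_norm_iteratedFDeriv_le k 0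
  refine ⟨fun _ => C, const_mem_span_one C, fun _ => hC, fun h z => ?_⟩
  refine (norm_iteratedFDeriv_comp_smul_le (ψ.smooth _) ?_ k z).trans ?_
  · rw [abs_of_pos h.2.1]; exact h.2.2
  · simpa using hb ((h : ℝ) • z)

section Oscillatory

variable {n : ℕ} {T : Submodule ℝ (Param → ℝ)} {r : ℕ}
  {b : Param → (Rn n × Rn n) × Rn n → ℂ}

/-- `(x, ξ) ↦ -ξ`. -/
noncomputable def negSnd (n : ℕ) : Rn n × Rn n →L[ℝ] Rn n := -ContinuousLinearMap.snd ℝ _ _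

/-- The iterated integral `∫ e^{ixξ} ∫ e^{-iyξ} b((x, ξ), y) dy dξ`. -/
noncomputable def iteratedIntegral (b : (Rn n × Rn n) × Rn n → ℂ) : Rn n → ℂ :=
  partialFourier (ContinuousLinearMap.id ℝ (Rn n)) (partialFourier (negSnd n) b)

/-- The `y`-integral at frequency `-ξ`; decay of order `K + r` beats the growth `(1+|ξ|)^r`. -/
theorem derivBound_inner
    (hb : ∀ K : ℕ, DerivBound T (fun p : (Rn n × Rn n) × Rn n =>
      (1 + ‖p.1.1‖) ^ r * (1 + ‖p.1.2‖) ^ r * ((1 + ‖p.2‖) ^ K)⁻¹) b) (K : ℕ) :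
    DerivBound T (fun p : Rn n × Rn n => (1 + ‖p.1‖) ^ r * ((1 + ‖p.2‖) ^ K)⁻¹)
      (fun ε => partialFourier (negSnd n) (b ε)) := by
  refine (DerivBound.partialFourier (w := fun z : Rn n × Rn n => (1 + ‖z.1‖) ^ r * (1 + ‖z.2‖) ^ r)
    (by fun_prop) (fun z => by positivity) (negSnd n) hb (K + r)).mono 1 zero_le_one
    fun p => le_of_eq ?_
  have : 0 < 1 + ‖p.2‖ := by positivity
  simp only [negSnd, neg_apply, ContinuousLinearMap.coe_snd', norm_neg,
    pow_add]
  field_simp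

/-- The `ξ`-integral at frequency `x`; now decay of order `K + r` beats `(1+|x|)^r`. -/
theorem derivBound_iteratedIntegral
    (hb : ∀ K : ℕ, DerivBound T (fun p : (Rn n × Rn n) × Rn n =>
      (1 + ‖p.1.1‖) ^ r * (1 + ‖p.1.2‖) ^ r * ((1 + ‖p.2‖) ^ K)⁻¹) b) (K : ℕ) :
    DerivBound T (fun x : Rn n => ((1 + ‖x‖) ^ K)⁻¹) (fun ε => iteratedIntegral (b ε)) := by
  refine (DerivBound.partialFourier (w := fun x : Rn n => (1 + ‖x‖) ^ r)
    (by fun_prop) (fun z => by positivity) (ContinuousLinearMap.id ℝ (Rn n))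
    (derivBound_inner hb) (K + r)).mono 1 zero_le_one fun p => le_of_eq ?_
  have : 0 < 1 + ‖p‖ := by positivity
  simp only [ContinuousLinearMap.id_apply, pow_add]
  field_simp

/-- The amplitude with the cutoff `ψ(hy, hξ)`. -/
noncomputable def cutoffAmplitude (b : (Rn n × Rn n) × Rn n → ℂ) (ψ : SchwartzMap (Rn n × Rn n) ℂ)
    (h : ℝ) (p : (Rn n × Rn n) × Rn n) : ℂ :=
  b p * ψ (h • (p.2, p.1.2))

theorem derivBound_cutoffAmplitude
    (hb : ∀ K : ℕ, DerivBound T (fun p : (Rn n × Rn n) × Rn n =>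
      (1 + ‖p.1.1‖) ^ r * (1 + ‖p.1.2‖) ^ r * ((1 + ‖p.2‖) ^ K)⁻¹) b)
    (ψ : SchwartzMap (Rn n × Rn n) ℂ) (ε : Param) (K : ℕ) :
    DerivBound (Submodule.span ℝ {(1 : Param → ℝ)}) (fun p : (Rn n × Rn n) × Rn n =>
      (1 + ‖p.1.1‖) ^ r * (1 + ‖p.1.2‖) ^ r * ((1 + ‖p.2‖) ^ K)⁻¹)
      (fun h : Param => cutoffAmplitude (b ε) ψ h) := by
  have h1 := (hb K).const ε (Submodule.span ℝ {(1 : Param → ℝ)}) const_mem_span_one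
  have h2 := (derivBound_dilate ψ).comp_clm ((ContinuousLinearMap.snd ℝ (Rn n × Rn n) (Rn n)).prod
    ((ContinuousLinearMap.snd ℝ _ _).comp (ContinuousLinearMap.fst ℝ (Rn n × Rn n) (Rn n))))
  exact (h1.bilinear h2 (fun C hC D hD => mul_mem_span_one hC hD)
    (ContinuousLinearMap.mul ℝ ℂ)).mono 1 zero_le_one fun p => by simp

theorem norm_exp_I_mul (t : ℝ) : ‖Complex.exp (Complex.I * t)‖ = 1 := by
  rw [mul_comm, Complex.norm_exp_ofReal_mul_I]

/-- The regularized integrand. -/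
theorem exp_phase_mul (b : (Rn n × Rn n) × Rn n → ℂ) (ψ : SchwartzMap (Rn n × Rn n) ℂ) (h : ℝ)
    (x : Rn n) (p : Rn n × Rn n) :
    Complex.exp (Complex.I * (phase p : ℝ)) *
      (Complex.exp (Complex.I * (⟪x, p.2⟫ : ℝ)) * b ((x, p.2), p.1)) * ψ (h • p) =
    Complex.exp (Complex.I * (⟪x, p.2⟫ : ℝ)) *
      (Complex.exp (Complex.I * (⟪negSnd n (x, p.2), p.1⟫ : ℝ)) •
        cutoffAmplitude b ψ h ((x, p.2), p.1)) := by
  have : phase p = ⟪negSnd n (x, p.2), p.1⟫ := by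
    simp only [phase, negSnd, neg_apply, ContinuousLinearMap.coe_snd',
      inner_neg_left]
    rw [real_inner_comm]
  rw [this, cutoffAmplitude, smul_eq_mul]
  ring

/-- For fixed `h` the cutoff decays rapidly in `(y, ξ)` jointly: `r` powers beat the growth of `b`
in `ξ`, and the remaining `d` give integrability. -/
theorem integrable_regularized
    (hb : ∀ K : ℕ, DerivBound T (fun p : (Rn n × Rn n) × Rn n =>
      (1 + ‖p.1.1‖) ^ r * (1 + ‖p.1.2‖) ^ r * ((1 + ‖p.2‖) ^ K)⁻¹) b)
    (ψ : SchwartzMap (Rn n × Rn n) ℂ) (ε : Param) (x : Rn n) {h : ℝ} (hh : 0 < h) :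
    Integrable fun p : Rn n × Rn n => Complex.exp (Complex.I * (phase p : ℝ)) *
      (Complex.exp (Complex.I * (⟪x, p.2⟫ : ℝ)) * b ε ((x, p.2), p.1)) * ψ (h • p) := by
  obtain ⟨C, -, hC0, hC⟩ := (hb 0).norm_le
  set d := Module.finrank ℝ (Rn n × Rn n) + 1
  obtain ⟨D, hD, hψ⟩ := ψ.exists_norm_iteratedFDeriv_le 0 (r + d)
  have hbc := ((hb 0).1 ε).continuous
  have hψc := ψ.continuous
  have hph : Continuous (phase : Rn n × Rn n → ℝ) := by unfold phase; fun_prop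
  have : (volume : Measure (Rn n × Rn n)).IsAddHaarMeasure := by
    rw [Measure.volume_eq_prod]; infer_instance
  refine integrable_of_norm_le_inv_pow
    (B := C ε * (1 + ‖x‖) ^ r * (D * (1 + h⁻¹) ^ (r + d))) (by fun_prop) fun p => ?_
  rw [norm_mul, norm_mul, norm_mul, norm_exp_I_mul, norm_exp_I_mul, one_mul, one_mul]
  have h1 : ‖b ε ((x, p.2), p.1)‖ ≤ C ε * (1 + ‖x‖) ^ r * (1 + ‖p‖) ^ r := by
    refine (hC ε ((x, p.2), p.1)).trans ?_
    simp only [pow_zero, inv_one, mul_one]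
    rw [← mul_assoc]
    have := hC0 ε
    simp only [Pi.zero_apply] at this
    gcongr
    exact norm_snd_le p
  have h2 : ‖ψ (h • p)‖ ≤ D * (1 + h⁻¹) ^ (r + d) * ((1 + ‖p‖) ^ (r + d))⁻¹ := by
    have h3 := hψ (h • p)
    rw [norm_iteratedFDeriv_zero] at h3
    have h4 : 1 + ‖p‖ ≤ (1 + h⁻¹) * (1 + ‖h • p‖) := by
      rw [norm_smul, Real.norm_of_nonneg hh.le]
      have : (1 + h⁻¹) * (1 + h * ‖p‖) = 1 + ‖p‖ + h⁻¹ + h * ‖p‖ := by field_simp; ring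
      rw [this]
      have : 0 ≤ h⁻¹ + h * ‖p‖ := by positivity
      linarith
    refine h3.trans ?_
    rw [mul_assoc]
    refine mul_le_mul_of_nonneg_left ?_ hD
    rw [← div_eq_mul_inv, inv_eq_one_div, div_le_div_iff₀ (by positivity) (by positivity), one_mul,
      ← mul_pow]
    exact pow_le_pow_left₀ (by positivity) h4 _
  have hp : 0 < 1 + ‖p‖ := by positivity
  refine (mul_le_mul h1 h2 (norm_nonneg _) ((norm_nonneg _).trans h1)).trans (le_of_eq ?_)
  rw [pow_add (1 + ‖p‖)]
  field_simp
  rfl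

/-- Fubini, with the `y`-integral taken inside. -/
theorem integral_regularized
    (hb : ∀ K : ℕ, DerivBound T (fun p : (Rn n × Rn n) × Rn n =>
      (1 + ‖p.1.1‖) ^ r * (1 + ‖p.1.2‖) ^ r * ((1 + ‖p.2‖) ^ K)⁻¹) b)
    (ψ : SchwartzMap (Rn n × Rn n) ℂ) (ε : Param) (x : Rn n) {h : ℝ} (hh : 0 < h) :
    ∫ p : Rn n × Rn n, Complex.exp (Complex.I * (phase p : ℝ)) *
      (Complex.exp (Complex.I * (⟪x, p.2⟫ : ℝ)) * b ε ((x, p.2), p.1)) * ψ (h • p) =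
    iteratedIntegral (cutoffAmplitude (b ε) ψ h) x := by
  have hi := integrable_regularized hb ψ ε x hh
  simp_rw [exp_phase_mul] at hi ⊢
  rw [Measure.volume_eq_prod] at hi ⊢
  rw [integral_prod_symm _ hi]
  simp_rw [integral_const_mul]
  rfl

theorem tendsto_inner
    (hb : ∀ K : ℕ, DerivBound T (fun p : (Rn n × Rn n) × Rn n =>
      (1 + ‖p.1.1‖) ^ r * (1 + ‖p.1.2‖) ^ r * ((1 + ‖p.2‖) ^ K)⁻¹) b)
    (ψ : SchwartzMap (Rn n × Rn n) ℂ) (hψ : ψ 0 = 1) (ε : Param) (z : Rn n × Rn n) :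
    Tendsto (fun h : ℝ => partialFourier (negSnd n) (cutoffAmplitude (b ε) ψ h) z) (𝓝[>] 0)
      (𝓝 (partialFourier (negSnd n) (b ε) z)) := by
  obtain ⟨D, hD, hψb⟩ := ψ.exists_norm_iteratedFDeriv_le 0 0
  have hbc := ((hb 0).1 ε).continuous
  have hψc := ψ.continuous
  have hint := DerivBound.integrable_snd (w := fun z : Rn n × Rn n => (1 + ‖z.1‖) ^ r *
    (1 + ‖z.2‖) ^ r) hb (negSnd n) ε z
  refine tendsto_integral_filter_of_dominated_convergence
    (fun v => ‖Complex.exp (Complex.I * (⟪negSnd n z, v⟫ : ℝ)) • b ε (z, v)‖ * D)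
    (Eventually.of_forall fun h => ?_) (Eventually.of_forall fun h => Eventually.of_forall
      fun v => ?_) (hint.norm.mul_const D) (Eventually.of_forall fun v => ?_)
  · refine Continuous.aestronglyMeasurable ?_
    unfold cutoffAmplitude
    fun_prop
  · rw [cutoffAmplitude, ← smul_mul_assoc, norm_mul]
    refine mul_le_mul_of_nonneg_left ?_ (norm_nonneg _)
    simpa using hψb (h • (v, z.2))
  · have h1 : Tendsto (fun h : ℝ => ψ (h • (v, z.2))) (𝓝[>] 0) (𝓝 1) := by
      have : Continuous fun h : ℝ => ψ (h • (v, z.2)) := by fun_prop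
      have h2 := this.tendsto 0
      rw [zero_smul, hψ] at h2
      exact h2.mono_left nhdsWithin_le_nhds
    have h3 := (h1.const_mul (b ε (z, v))).const_smul
      (Complex.exp (Complex.I * (⟪negSnd n z, v⟫ : ℝ)))
    rwa [mul_one] at h3

/-- The oscillatory integral exists and equals the iterated integral. -/
theorem isOscIntegral_iteratedIntegral
    (hb : ∀ K : ℕ, DerivBound T (fun p : (Rn n × Rn n) × Rn n =>
      (1 + ‖p.1.1‖) ^ r * (1 + ‖p.1.2‖) ^ r * ((1 + ‖p.2‖) ^ K)⁻¹) b) (ε : Param) (x : Rn n) :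
    IsOscIntegral phase
      (fun p => Complex.exp (Complex.I * (⟪x, p.2⟫ : ℝ)) * b ε ((x, p.2), p.1))
      (iteratedIntegral (b ε) x) := by
  intro ψ hψ
  refine ⟨fun h hh => integrable_regularized hb ψ ε x hh, ?_⟩
  have hev : ∀ᶠ h : ℝ in 𝓝[>] 0, h ∈ Set.Ioc (0 : ℝ) 1 := Ioc_mem_nhdsGT zero_lt_one
  refine Tendsto.congr' (f₁ := fun h : ℝ => iteratedIntegral (cutoffAmplitude (b ε) ψ h) x)
    (hev.mono fun h hh => (integral_regularized hb ψ ε x hh.1).symm) ?_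
  -- Integration by parts in `y` for the cut-off amplitudes, uniformly in `h`, yields the integrable
  -- majorant in `ξ`; the inner integrals converge pointwise by `tendsto_inner`.
  have hG := derivBound_inner (derivBound_cutoffAmplitude hb ψ ε)
  obtain ⟨C, hC, -, hCb⟩ := (hG (Module.finrank ℝ (Rn n) + 1)).norm_le
  obtain ⟨c, rfl⟩ := Submodule.mem_span_singleton.1 hC
  refine tendsto_integral_filter_of_dominated_convergence
    (fun ξ => c * (1 + ‖x‖) ^ r * ((1 + ‖ξ‖) ^ (Module.finrank ℝ (Rn n) + 1))⁻¹)
    (hev.mono fun h hh => ?_) (hev.mono fun h hh => Eventually.of_forall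
      fun ξ => ?_) ((integrable_one_add_norm_pow_inv (Rn n) volume).const_mul _)
    (Eventually.of_forall fun ξ => (tendsto_inner hb ψ hψ ε (x, ξ)).const_smul _)
  · have := ((hG 0).1 ⟨h, hh⟩).continuous
    refine Continuous.aestronglyMeasurable ?_
    simp only at this
    fun_prop
  · rw [norm_smul, norm_exp_I_mul, one_mul]
    simpa [mul_assoc] using hCb ⟨h, hh⟩ (x, ξ)

end Oscillatory

/-! ### Uniqueness and linearity of oscillatory integrals -/

/-- At least one admissible cutoff is needed; otherwise every number would be a value of the
oscillatory integral. -/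
theorem exists_schwartzMap_one (V : Type) [NormedAddCommGroup V] [NormedSpace ℝ V]
    [FiniteDimensional ℝ V] : ∃ ψ : SchwartzMap V ℂ, ψ 0 = 1 := by
  let f : ContDiffBump (0 : V) := ⟨1, 2, zero_lt_one, one_lt_two⟩
  have h1 : HasCompactSupport fun x => (f x : ℂ) := f.hasCompactSupport.comp_left Complex.ofReal_zero
  have h2 : ContDiff ℝ ∞ fun x => (f x : ℂ) := Complex.ofRealCLM.contDiff.comp f.contDiff
  refine ⟨h1.toSchwartzMap h2, ?_⟩
  change ((f 0 : ℝ) : ℂ) = 1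
  rw [f.one_of_mem_closedBall (by simp [f]), Complex.ofReal_one]

section IsOscIntegral

variable {V : Type} [NormedAddCommGroup V] [NormedSpace ℝ V] [MeasureSpace V]
  {θ : V → ℝ} {b b' : V → ℂ} {I J : ℂ}

theorem Colombeau.IsOscIntegral.unique [FiniteDimensional ℝ V] (h : IsOscIntegral θ b I)
    (h' : IsOscIntegral θ b J) :
    I = J := by
  obtain ⟨ψ, hψ⟩ := exists_schwartzMap_one V
  exact tendsto_nhds_unique (h ψ hψ).2 (h' ψ hψ).2

theorem Colombeau.IsOscIntegral.oscIntegral_eq [FiniteDimensional ℝ V]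
    (h : IsOscIntegral θ b I) :
    oscIntegral θ b = I := by
  have he : ∃ I, IsOscIntegral θ b I := ⟨I, h⟩
  rw [oscIntegral, dif_pos he]
  exact he.choose_spec.unique h

theorem Colombeau.IsOscIntegral.add (h : IsOscIntegral θ b I) (h' : IsOscIntegral θ b' J) :
    IsOscIntegral θ (fun z => b z + b' z) (I + J) := by
  intro ψ hψ
  have e : ∀ h : ℝ, (fun z => Complex.exp (Complex.I * θ z) * (b z + b' z) * ψ (h • z)) =
      fun z => Complex.exp (Complex.I * θ z) * b z * ψ (h • z) +
        Complex.exp (Complex.I * θ z) * b' z * ψ (h • z) := fun h => by ext z; ring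
  refine ⟨fun t ht => ?_, ?_⟩
  · rw [e]
    exact ((h ψ hψ).1 t ht).add ((h' ψ hψ).1 t ht)
  · refine ((h ψ hψ).2.add (h' ψ hψ).2).congr' ?_
    filter_upwards [self_mem_nhdsWithin] with t ht
    rw [e, integral_add ((h ψ hψ).1 t ht) ((h' ψ hψ).1 t ht)]

theorem Colombeau.IsOscIntegral.const_mul (h : IsOscIntegral θ b I) (c : ℂ) :
    IsOscIntegral θ (fun z => c * b z) (c * I) := by
  intro ψ hψ
  have e : ∀ h : ℝ, (fun z => Complex.exp (Complex.I * θ z) * (c * b z) * ψ (h • z)) =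
      fun z => c * (Complex.exp (Complex.I * θ z) * b z * ψ (h • z)) := fun h => by ext z; ring
  refine ⟨fun t ht => ?_, ?_⟩
  · rw [e]
    exact ((h ψ hψ).1 t ht).const_mul c
  · simp_rw [e, integral_const_mul]
    exact (h ψ hψ).2.const_mul c

end IsOscIntegral

/-! ### Mapping properties of the operator -/

theorem integrand_eq {n : ℕ} (φ : SchwartzMap (Rn n) ℂ) (a : Net (Rn n × Rn n × Rn n))
    (u : Net (Rn n)) (ε : Param) (x : Rn n) :
    integrand φ a u ε x = fun p =>
      Complex.exp (Complex.I * (⟪x, p.2⟫ : ℝ)) * fullAmplitude φ a u ε ((x, p.2), p.1) := by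
  ext p
  simp only [integrand, fullAmplitude]
  ring

theorem isOscIntegral_integrand {n : ℕ} {T₁ T₂ T : Submodule ℝ (Param → ℝ)}
    (hT₂ : ∀ C ∈ moderate, ∀ D ∈ T₂, C * D ∈ T₂) (hT : ∀ C ∈ T₁, ∀ D ∈ T₂, C * D ∈ T)
    (φ : SchwartzMap (Rn n) ℂ) {a : Net (Rn n × Rn n × Rn n)} {r : ℕ}
    (ha : DerivBound T₁ (polyWeight r) a) {u : Net (Rn n)} (hu : PolyBound T₂ u) (ε : Param)
    (x : Rn n) :
    IsOscIntegral phase (integrand φ a u ε x) (iteratedIntegral (fullAmplitude φ a u ε) x) := by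
  rw [integrand_eq]
  exact isOscIntegral_iteratedIntegral (derivBound_fullAmplitude hT₂ hT φ ha hu) ε x

/-- The estimate behind all three mapping properties: `T₁` governs the amplitude, `T₂` the net and
`T` the result. -/
theorem derivBound_psiDO {n : ℕ} {T₁ T₂ T : Submodule ℝ (Param → ℝ)}
    (hT₂ : ∀ C ∈ moderate, ∀ D ∈ T₂, C * D ∈ T₂) (hT : ∀ C ∈ T₁, ∀ D ∈ T₂, C * D ∈ T)
    (φ : SchwartzMap (Rn n) ℂ) {a : Net (Rn n × Rn n × Rn n)} {r : ℕ}
    (ha : DerivBound T₁ (polyWeight r) a) {u : Net (Rn n)} (hu : PolyBound T₂ u) (K : ℕ) :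
    DerivBound T (fun x : Rn n => ((1 + ‖x‖) ^ K)⁻¹) (psiDO φ a u) := by
  have e : psiDO φ a u = fun ε x =>
      ((((2 * Real.pi) ^ n)⁻¹ : ℝ) • ContinuousLinearMap.id ℝ ℂ)
        (iteratedIntegral (fullAmplitude φ a u ε) x) := by
    ext ε x
    rw [psiDO, (isOscIntegral_integrand hT₂ hT φ ha hu ε x).oscIntegral_eq]
    exact (Complex.real_smul).symm
  rw [e]
  exact (derivBound_iteratedIntegral (derivBound_fullAmplitude hT₂ hT φ ha hu) K).clm_comp _

/-! ### From weighted bounds back to the spaces of nets -/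

theorem DerivBound.mem_ETau {n : ℕ} {u : Net (Rn n)}
    (hu : ∀ K : ℕ, DerivBound moderate (fun x : Rn n => ((1 + ‖x‖) ^ K)⁻¹) u) : u ∈ ETau n := by
  refine ⟨(hu 0).1, fun α => ?_⟩
  obtain ⟨C, ⟨N, c, hc⟩, hC0, h⟩ := (hu 0).2 (order α)
  refine ⟨N, c, fun ε x => ?_⟩
  have hε : (0 : ℝ) < ε := ε.2.1
  have hj : (japanese x ^ N)⁻¹ ≤ 1 := inv_le_one_of_one_le₀ (one_le_pow₀ (one_le_japanese x))
  have h1 : ‖partialD α (u ε) x‖ ≤ c * ((ε : ℝ) ^ N)⁻¹ := by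
    refine (norm_partialD_le α (u ε) x).trans ((h ε x).trans ?_)
    simpa using (le_abs_self _).trans (hc ε)
  calc (ε : ℝ) ^ N * ((japanese x ^ N)⁻¹ * ‖partialD α (u ε) x‖)
      ≤ (ε : ℝ) ^ N * (c * ((ε : ℝ) ^ N)⁻¹) := by
        refine mul_le_mul_of_nonneg_left ?_ (by positivity)
        exact (mul_le_of_le_one_left (norm_nonneg _) hj).trans h1
    _ = c := by field_simp

theorem abs_monomial_le {n : ℕ} (α : Fin n → ℕ) (x : Rn n) :
    |monomial α x| ≤ (1 + ‖x‖) ^ order α := by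
  rw [monomial, Finset.abs_prod, order, ← Finset.prod_pow_eq_pow_sum]
  refine Finset.prod_le_prod (fun _ _ => abs_nonneg _) fun i _ => ?_
  rw [abs_pow]
  refine pow_le_pow_left₀ (abs_nonneg _) ?_ _
  have : |x i| ≤ ‖x‖ := PiLp.norm_apply_le x i
  linarith

theorem DerivBound.mem_NS {n : ℕ} {u : Net (Rn n)}
    (hu : ∀ K : ℕ, DerivBound negligible (fun x : Rn n => ((1 + ‖x‖) ^ K)⁻¹) u) : u ∈ NS n := by
  refine ⟨(hu 0).1, fun α β q => ?_⟩
  -- Decay of order `|α|` exactly cancels the monomial.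
  obtain ⟨C, hC, hC0, h⟩ := (hu (order α)).2 (order β)
  obtain ⟨c, hc⟩ := hC q
  refine ⟨c, fun ε x => ?_⟩
  have hε : (0 : ℝ) < ε := ε.2.1
  rw [inv_mul_le_iff₀ (by positivity), norm_mul, Complex.norm_real, Real.norm_eq_abs]
  calc |monomial α x| * ‖partialD β (u ε) x‖
      ≤ (1 + ‖x‖) ^ order α * (C ε * ((1 + ‖x‖) ^ order α)⁻¹) :=
        mul_le_mul (abs_monomial_le α x) ((norm_partialD_le β (u ε) x).trans (h ε x))
          (norm_nonneg _) (by positivity)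
    _ = C ε := by field_simp
    _ ≤ (ε : ℝ) ^ q * c := by rw [mul_comm]; exact (le_abs_self _).trans (hc ε)

theorem theorem5p1 (n : ℕ) (φ : SchwartzMap (Rn n) ℂ) (hφ : IsMollifier φ)
    (Λ : R2n n → ℝ) (hΛ : IsWeight Λ) (m ρ : ℝ) (hρ : ρ ∈ Set.Ioc (0 : ℝ) 1)
    (a : Net (Rn n × Rn n × Rn n)) (ha : a ∈ Amplitude Λ m ρ) :
    (∀ u ∈ ETau n, ∀ (ε : Param) (x : Rn n),
      ∃ I : ℂ, IsOscIntegral phase (integrand φ a u ε x) I) ∧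
    (∀ u ∈ ETau n, psiDO φ a u ∈ ETau n) ∧
    (∀ u ∈ NS n, psiDO φ a u ∈ NS n) ∧
    (a ∈ NegligibleAmplitude Λ m ρ → ∀ u ∈ ETau n, psiDO φ a u ∈ NS n) ∧
    (∃! A : GTauS n →ₗ[ℂ] GTauS n, ∀ u : ETau n,
      ∃ h : psiDO φ a (u : Net (Rn n)) ∈ ETau n,
        A (GTauS.mk u) = GTauS.mk ⟨psiDO φ a (u : Net (Rn n)), h⟩) := by
  obtain ⟨r, har⟩ := Amplitude.derivBound hΛ hρ.1.le ha
  have hmm : ∀ C ∈ moderate, ∀ D ∈ moderate, C * D ∈ moderate :=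
    fun C hC D hD => moderate_mul hC hD
  have hmn : ∀ C ∈ moderate, ∀ D ∈ negligible, C * D ∈ negligible :=
    fun C hC D hD => moderate_mul_negligible hC hD
  have hosc : ∀ u ∈ ETau n, ∀ (ε : Param) (x : Rn n), IsOscIntegral phase (integrand φ a u ε x)
      (oscIntegral phase (integrand φ a u ε x)) := fun u hu ε x => by
    have h := isOscIntegral_integrand hmm hmm φ har (ETau.polyBound hu) ε x
    rwa [h.oscIntegral_eq]
  have hE : ∀ u ∈ ETau n, psiDO φ a u ∈ ETau n := fun u hu =>
    DerivBound.mem_ETau (derivBound_psiDO hmm hmm φ har (ETau.polyBound hu))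
  have hN : ∀ u ∈ NS n, psiDO φ a u ∈ NS n := fun u hu =>
    DerivBound.mem_NS (derivBound_psiDO hmn hmn φ har (NS.polyBound hu))
  refine ⟨fun u hu ε x => ⟨_, hosc u hu ε x⟩, hE, hN, fun han u hu => ?_, ?_⟩
  · obtain ⟨s, has⟩ := NegligibleAmplitude.derivBound hΛ hρ.1.le han
    exact DerivBound.mem_NS (derivBound_psiDO hmm
      (fun C hC D hD => mul_comm D C ▸ moderate_mul_negligible hD hC) φ has (ETau.polyBound hu))
  -- Linearity on nets: sums and multiples of oscillatory values are values for the combined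
  -- integrand, and the value is unique. Claim 2 then lets the map descend to the quotient.
  · let Φ : ETau n →ₗ[ℂ] ETau n :=
      { toFun := fun u => ⟨psiDO φ a u, hE u u.2⟩
        map_add' := fun u v => by
          ext ε x
          change psiDO φ a (u + v : Net (Rn n)) ε x = psiDO φ a u ε x + psiDO φ a v ε x
          simp only [psiDO]
          rw [← mul_add]
          congr 1
          refine IsOscIntegral.oscIntegral_eq ?_
          convert (hosc u u.2 ε x).add (hosc v v.2 ε x) using 2
          simp only [integrand, Pi.add_apply]
          ring
        map_smul' := fun c u => by
          ext ε x
          change psiDO φ a (c • (u : Net (Rn n))) ε x = c * psiDO φ a u ε x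
          simp only [psiDO]
          rw [mul_left_comm]
          congr 1
          refine IsOscIntegral.oscIntegral_eq ?_
          convert (hosc u u.2 ε x).const_mul c using 2
          simp only [integrand, Pi.smul_apply, smul_eq_mul]
          ring }
    refine ⟨Submodule.mapQ _ _ Φ fun u hu => hN u hu, fun u => ⟨hE u u.2, rfl⟩, fun B hB => ?_⟩
    refine Submodule.linearMap_qext _ (LinearMap.ext fun u => ?_)
    obtain ⟨h, hu⟩ := hB u
    exact hu
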